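/- **Setting.** A unit is $(X,Y(1),Y(0),D,R)\sim Q$ with $X\in\mathbb R^k$, real potential outcomes, treatment $D\in\{0,1\}$ and response $R\in\{0,1\}$ ($R=0$: attrition); $Y^{\rm obs}=Y(D)$. Assume (1) $(Y(1),Y(0))\perp D\mid X$; (2) $(Y(1),Y(0))\perp R\mid X,D$; (3) for some $c>0$, almost surely $c<P(D=1\mid X)<1-c$ and $c<e_R<1-c$, where $e_R=P(R=1\mid X,D)$. Put $\pi_R=e_R/(1-e_R)$. On training data the following measurable functions are learned: intervals $\mathcal C_d(x)=[l_d(x),u_d(x)]$ for $Y(d)$, regressions $\hat h^L,\hat h^R$, and estimators $\hat m_{\mathcal C}(\eta,x,d)$ and $\hat\pi_R(x,d)$. Let $\mathcal C_{\rm ITE}=[\mathcal C^L,\mathcal C^R]$ be $Y^{\rm obs}-\mathcal C_0(X)$ if $D=1$ and $\mathcal C_1(X)-Y^{\rm obs}$ if $D=0$, let $V_{\mathcal C}=\max\{\hat h^L(X)-\mathcal C^L,\ \mathcal C^R-\hat h^R(X)\}$, and let $m_{\mathcal C}(\eta,X,D)=P(V_{\mathcal C}<\eta\mid X,D,R=1)$.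 For $\gamma\in(0,1)$ put $$\psi(\eta)=(1-R)\bigl[\hat m_{\mathcal C}(\eta,X,D)-(1-\gamma)\bigr]+\frac{R}{\hat\pi_R(X,D)}\bigl[\mathbf 1\{V_{\mathcal C}<\eta\}-\hat m_{\mathcal C}(\eta,X,D)\bigr].$$ Given a calibration sample $\mathcal I_2$ of $N=|\mathcal I_2|\ge1$ i.i.d. units with law $Q$, independent of the training data, let $\hat\eta\in[-\infty,\infty]$ be the smallest $\eta$ (the infimum of all $\eta\in\mathbb R$) with $\frac1N\sum_{i\in\mathcal I_2}\psi_i(\eta)\ge0$, assumed to be a measurable function of the data, and let $\check{\mathcal C}(x)=[\hat h^L(x)-\hat\eta,\hat h^R(x)+\hat\eta]$. Assume that $|\hat m_{\mathcal C}|\le m_0$, that $|\hat\pi_R|\ge\pi_0$ with $0<\pi_0\le1$, and that $\hat m_{\mathcal C}$ is non-decreasing in $\eta$. Below, probabilities given $R=0$ and the norms $\|\cdot\|_2=\|\cdot\|_{L^2(Q)}$ refer to a fresh unit, with the training and calibration data held fixed. **Theorem.** There are universal constants $C_0,C_1>0$ such that, for every $\delta>0$, with $$\Delta=\frac{C_0\,\pi_0^{-1}(1+m_0)}{P(R=0)}\sqrt{\frac{\log(1/\delta)+1}{|\mathcal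 I_2|}}+\frac{C_1\,\pi_0^{-1}}{P(R=0)}\,\|\hat\pi_R-\pi_R\|_2\cdot\sup_{\eta\in\mathbb R}\|\hat m_{\mathcal C}(\eta,\cdot)-m_{\mathcal C}(\eta,\cdot)\|_2 ,$$ each of the following holds with probability at least $1-\delta$ over the training and calibration data: (a) $P(V_{\mathcal C}<\hat\eta\mid R=0)\ge1-\gamma-\Delta$, provided that the smallest solution $\hat\eta$ is almost surely attained or that the law of $V_{\mathcal C}$ given $R=0$ has no atoms for almost every realization of the training data; (b) $P(\mathcal C_{\rm ITE}\subseteq\check{\mathcal C}(X)\mid R=0)\ge1-\gamma-\Delta$; (c) $P(Y(1)-Y(0)\in\check{\mathcal C}(X)\mid R=0)\ge 1-\bigl(P(Y(1)-Y(0)\notin\mathcal C_{\rm ITE}\mid R=0)+\gamma\bigr)-\Delta$. Consequently, along a sequence of such procedures with $Q,\gamma,m_0,\pi_0$ fixed and $|\mathcal I_2|\to\infty$: if the first-step intervals have asymptotic level $1-\alpha$ in the attrition group for some $\alpha\in(0,1)$, that is $P(Y(1)-Y(0)\notin\mathcal C_{\rm ITE}\mid R=0)\le\alpha+o_p(1)$,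 and $\|\hat\pi_R-\pi_R\|_2\cdot\sup_\eta\|\hat m_{\mathcal C}(\eta,\cdot)-m_{\mathcal C}(\eta,\cdot)\|_2=o_p(1)$, then $$P(Y(1)-Y(0)\in\check{\mathcal C}(X)\mid R=0)\ge1-(\alpha+\gamma)-o_p(1).$$ -/

import Mathlib

open MeasureTheory ProbabilityTheory Filter
open scoped ENNReal Topology

noncomputable section

namespace Attrition

/-- Covariate space `ℝ^k`. -/
abbrev Cov (k : ℕ) := EuclideanSpace ℝ (Fin k)

/-- A unit `(X, Y(1), Y(0), D, R)`; for `D` and `R` the value `true` stands for `1`. -/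
abbrev Obs (k : ℕ) := Cov k × ℝ × ℝ × Bool × Bool

variable {k : ℕ}

/-- Covariates. -/
def X (o : Obs k) : Cov k := o.1

/-- Potential outcome under treatment. -/
def Y1 (o : Obs k) : ℝ := o.2.1

/-- Potential outcome under control. -/
def Y0 (o : Obs k) : ℝ := o.2.2.1

/-- Treatment indicator. -/
def D (o : Obs k) : Bool := o.2.2.2.1

/-- Response indicator: `false` means attrition. -/
def R (o : Obs k) : Bool := o.2.2.2.2

/-- The outcome under the received treatment (recorded only if `R = 1`). -/
def Yobs (o : Obs k) : ℝ := if D o then Y1 o else Y0 o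

/-- The individual treatment effect. -/
def effect (o : Obs k) : ℝ := Y1 o - Y0 o

/-- The pair of potential outcomes. -/
def potential (o : Obs k) : ℝ × ℝ := (Y1 o, Y0 o)

/-- Covariates together with treatment. -/
def XD (o : Obs k) : Cov k × Bool := (X o, D o)

lemma measurable_X : Measurable (X (k := k)) := measurable_fst

lemma measurable_XD : Measurable (XD (k := k)) :=
  measurable_fst.prodMk (measurable_fst.comp
    (measurable_snd.comp (measurable_snd.comp measurable_snd)))

/-- The σ-algebra generated by `X`. -/
@[reducible] def sigmaX (k : ℕ) : MeasurableSpace (Obs k) := MeasurableSpace.comap X inferInstance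

/-- The σ-algebra generated by `(X, D)`. -/
@[reducible] def sigmaXD (k : ℕ) : MeasurableSpace (Obs k) := MeasurableSpace.comap XD inferInstance

lemma sigmaX_le : sigmaX k ≤ (inferInstance : MeasurableSpace (Obs k)) :=
  measurable_X.comap_le

lemma sigmaXD_le : sigmaXD k ≤ (inferInstance : MeasurableSpace (Obs k)) :=
  measurable_XD.comap_le

/-- Unconfoundedness: `(Y(1), Y(0)) ⫫ D | X`. -/
def Unconfounded (Q : Measure (Obs k)) [IsFiniteMeasure Q] : Prop :=
  CondIndepFun (sigmaX k) sigmaX_le potential D Q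

/-- Missingness at random: `(Y(1), Y(0)) ⫫ R | X, D`. -/
def MissingAtRandom (Q : Measure (Obs k)) [IsFiniteMeasure Q] : Prop :=
  CondIndepFun (sigmaXD k) sigmaXD_le potential R Q

/-- Treatment propensity `e_D(X) = P(D = 1 | X)`. -/
def eD (Q : Measure (Obs k)) : Obs k → ℝ :=
  Q[Set.indicator {o | D o = true} (fun _ => (1 : ℝ)) | sigmaX k]

/-- Response propensity `e_R(X, D) = P(R = 1 | X, D)`. -/
def eR (Q : Measure (Obs k)) : Obs k → ℝ :=
  Q[Set.indicator {o | R o = true} (fun _ => (1 : ℝ)) | sigmaXD k]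

/-- Overlap for both propensities. -/
def Overlap (Q : Measure (Obs k)) : Prop :=
  ∃ c : ℝ, 0 < c ∧ (∀ᵐ o ∂Q, c < eD Q o ∧ eD Q o < 1 - c) ∧
    ∀ᵐ o ∂Q, c < eR Q o ∧ eR Q o < 1 - c

/-- The law of a unit given `R = 0`. -/
def attrited (Q : Measure (Obs k)) : Measure (Obs k) := ProbabilityTheory.cond Q {o | R o = false}

/-- The law of a unit given `R = 1`. -/
def responding (Q : Measure (Obs k)) : Measure (Obs k) := ProbabilityTheory.cond Q {o | R o = true}

/-- `P(R = 0)`. -/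
def probAttrition (Q : Measure (Obs k)) : ℝ := Q.real {o | R o = false}

/-- The odds `π_R(X, D) = P(R = 1 | X, D) / P(R = 0 | X, D)`. -/
def piR (Q : Measure (Obs k)) (o : Obs k) : ℝ := eR Q o / (1 - eR Q o)

/-- Everything that is learned on the training fold: the endpoints of the counterfactual intervals
`C_d(x) = [lower d x, upper d x]`, the endpoint regressions `ĥ^L, ĥ^R`, the estimate `m̂_C(η, x, d)`
of the conditional distribution function of the score, and the estimate `π̂_R(x, d)` of the odds. -/
structure Fit (k : ℕ) where
  lower : Bool → Cov k → ℝ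
  upper : Bool → Cov k → ℝ
  hL : Cov k → ℝ
  hR : Cov k → ℝ
  mHat : ℝ → Cov k → Bool → ℝ
  piHat : Cov k → Bool → ℝ

namespace Fit

variable (F : Fit k)

/-- Left endpoint of the surrogate interval `C_ITE`, which is `Y^obs - C_0(X)` if `D = 1` and
`C_1(X) - Y^obs` if `D = 0`. -/
def cL (o : Obs k) : ℝ :=
  if D o then Yobs o - F.upper false (X o) else F.lower true (X o) - Yobs o

/-- Right endpoint of the surrogate interval `C_ITE`. -/
def cR (o : Obs k) : ℝ :=
  if D o then Yobs o - F.lower false (X o) else F.upper true (X o) - Yobs o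

/-- The surrogate interval `C_ITE(X; D, Y^obs)`. -/
def surrogate (o : Obs k) : Set ℝ := Set.Icc (F.cL o) (F.cR o)

/-- The nonconformity score `V_C`. -/
def score (o : Obs k) : ℝ := max (F.hL (X o) - F.cL o) (F.cR o - F.hR (X o))

/-- The interval `[ĥ^L(x) - η, ĥ^R(x) + η]` of reals, for a threshold `η ∈ [-∞, ∞]`
(all of `ℝ` for `η = ∞`, empty for `η = -∞`). -/
def expanded (η : EReal) (x : Cov k) : Set ℝ :=
  {y : ℝ | ((F.hL x - y : ℝ) : EReal) ≤ η ∧ ((y - F.hR x : ℝ) : EReal) ≤ η}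

open Classical in
/-- The estimated influence function `ψ_C(η; m̂_C, π̂_R)` at level `γ`. -/
def psi (γ η : ℝ) (o : Obs k) : ℝ :=
  (1 - (if R o then 1 else 0)) * (F.mHat η (X o) (D o) - (1 - γ))
    + (if R o then 1 else 0) / F.piHat (X o) (D o)
      * ((if F.score o < η then 1 else 0) - F.mHat η (X o) (D o))

/-- The thresholds that satisfy the sample moment condition on a calibration sample. -/
def solutions (γ : ℝ) {N : ℕ} (s : Fin N → Obs k) : Set ℝ :=
  {η : ℝ | 0 ≤ (1 / (N : ℝ)) * ∑ i, F.psi γ η (s i)}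

/-- The threshold `η̂`: the smallest solution, understood as the infimum in `[-∞, ∞]` (the set of
solutions need not contain its infimum, since `η ↦ 1{V < η}` is only left continuous). -/
def etaHat (γ : ℝ) {N : ℕ} (s : Fin N → Obs k) : EReal :=
  sInf ((fun η : ℝ => (η : EReal)) '' F.solutions γ s)

/-- The smallest solution exists as a real number. -/
def Attained (γ : ℝ) {N : ℕ} (s : Fin N → Obs k) : Prop :=
  ∃ η : ℝ, IsLeast (F.solutions γ s) η

/-- The true conditional distribution function `m_C(η, X, D) = P(V_C < η | X, D, R = 1)`. -/
def mC (Q : Measure (Obs k)) (η : ℝ) : Obs k → ℝ :=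
  (responding Q)[Set.indicator {o | F.score o < η} (fun _ => (1 : ℝ)) | sigmaXD k]

/-- `‖π̂_R(X, D) - π_R(X, D)‖₂`. -/
def piError (Q : Measure (Obs k)) : ℝ≥0∞ :=
  eLpNorm (fun o => F.piHat (X o) (D o) - piR Q o) 2 Q

/-- `sup_η ‖m̂_C(η, X, D) - m_C(η, X, D)‖₂`. -/
def mError (Q : Measure (Obs k)) : ℝ≥0∞ :=
  ⨆ η : ℝ, eLpNorm (fun o => F.mHat η (X o) (D o) - F.mC Q η o) 2 Q

/-- `m̂_C` is bounded by `m₀` and non-decreasing in `η`, and `|π̂_R|` is at least `π₀`. -/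
structure Regular (m₀ π₀ : ℝ) : Prop where
  bound : ∀ η x d, |F.mHat η x d| ≤ m₀
  lower : ∀ x d, π₀ ≤ |F.piHat x d|
  mono : ∀ x d, Monotone fun η => F.mHat η x d

/-- `P(V_C < η | R = 0)`. -/
def coverage (Q : Measure (Obs k)) (η : EReal) : ℝ≥0∞ :=
  attrited Q {o | (F.score o : EReal) < η}

/-- `P(C_ITE ⊆ [ĥ^L(X) - η, ĥ^R(X) + η] | R = 0)`. -/
def containment (Q : Measure (Obs k)) (η : EReal) : ℝ≥0∞ :=
  attrited Q {o | F.surrogate o ⊆ F.expanded η (X o)}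

/-- `P(Y(1) - Y(0) ∈ [ĥ^L(X) - η, ĥ^R(X) + η] | R = 0)`. -/
def iteCoverage (Q : Measure (Obs k)) (η : EReal) : ℝ≥0∞ :=
  attrited Q {o | effect o ∈ F.expanded η (X o)}

/-- `P(Y(1) - Y(0) ∉ C_ITE | R = 0)`. -/
def surrogateMiss (Q : Measure (Obs k)) : ℝ≥0∞ :=
  attrited Q {o | effect o ∉ F.surrogate o}

/-- The law of the score given `R = 0` has no atoms. -/
def Atomless (Q : Measure (Obs k)) : Prop :=
  ∀ v : ℝ, attrited Q {o | F.score o = v} = 0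

/-- The sampling error
`C₀ π₀⁻¹ (1 + m₀) / P(R = 0) * √((log (1 / δ) + 1) / N)`. -/
def _root_.Attrition.samplingError (Q : Measure (Obs k)) (C₀ m₀ π₀ δ : ℝ) (N : ℕ) : ℝ :=
  C₀ * (π₀⁻¹ * (1 + m₀) / probAttrition Q) * Real.sqrt ((Real.log (1 / δ) + 1) / N)

/-- The product error `C₁ π₀⁻¹ / P(R = 0) * ‖π̂_R - π_R‖₂ * sup_η ‖m̂_C - m_C‖₂`. -/
def productError (Q : Measure (Obs k)) (C₁ π₀ : ℝ) : ℝ≥0∞ :=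
  ENNReal.ofReal (C₁ * π₀⁻¹ / probAttrition Q) * (F.piError Q * F.mError Q)

end Fit

/-- A learning rule on training data in `𝒯` all of whose outputs are jointly measurable in the
training data and their arguments. -/
structure MeasurableFit {𝒯 : Type*} [MeasurableSpace 𝒯] (L : 𝒯 → Fit k) : Prop where
  lower : ∀ d, Measurable fun p : 𝒯 × Cov k => (L p.1).lower d p.2
  upper : ∀ d, Measurable fun p : 𝒯 × Cov k => (L p.1).upper d p.2
  hL : Measurable fun p : 𝒯 × Cov k => (L p.1).hL p.2
  hR : Measurable fun p : 𝒯 × Cov k => (L p.1).hR p.2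
  mHat : ∀ d, Measurable fun p : 𝒯 × ℝ × Cov k => (L p.1).mHat p.2.1 p.2.2 d
  piHat : ∀ d, Measurable fun p : 𝒯 × Cov k => (L p.1).piHat p.2 d

/-- The joint law of the training data (law `τ`) and of an independent calibration sample of `N`
independent units with law `Q`. -/
def dataLaw {𝒯 : Type*} [MeasurableSpace 𝒯] (τ : Measure 𝒯) (Q : Measure (Obs k)) (N : ℕ) :
    Measure (𝒯 × (Fin N → Obs k)) :=
  τ.prod (Measure.pi fun _ => Q)

end Attrition

end

/-!
Given `(X, D)`, the response is independent of the potential outcomes, so conditional expectations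
given `R = 1` transfer to the whole population and
`E ψ(η) = P(R = 0) (P(V_C < η | R = 0) - (1 - γ)) + E[b (m̂_C(η) - m_C(η))]`,
where `b = (1 - e_R) - e_R / π̂_R` satisfies `|b| ≤ π₀⁻¹ |π̂_R - π_R|`. By Cauchy–Schwarz the last
term is at most the product of the two `L²` errors.

As a function of `η`, `ψ` is a difference of two bounded monotone processes, so its sample means
deviate from `E ψ` by `O(√((log (1 / δ) + 1) / N))` uniformly in `η`: by symmetrization, the
supremum of the signed sums reduces to the maximal partial sum of independent signs, for which
Lévy's inequality costs only a factor of two. Outside this event every solution of the sample moment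
condition has nearly nominal coverage, and so has their infimum `η̂`, except that `V_C < η` turns
into `V_C ≤ η` in the limit when `η̂` is not attained.
-/

namespace Attrition

lemma ofReal_exp_integral_le_lintegral {α : Type*} [MeasurableSpace α] {μ : Measure α}
    [IsProbabilityMeasure μ] {g : α → ℝ} (hg : Integrable g μ) :
    ENNReal.ofReal (Real.exp (∫ a, g a ∂μ)) ≤ ∫⁻ a, ENNReal.ofReal (Real.exp (g a)) ∂μ := by
  by_cases hexp : Integrable (fun a => Real.exp (g a)) μ
  · rw [← ofReal_integral_eq_lintegral_ofReal hexp (ae_of_all _ fun _ => (Real.exp_pos _).le)]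
    exact ENNReal.ofReal_le_ofReal <| convexOn_exp.map_integral_le Real.continuous_exp.continuousOn
      isClosed_univ (ae_of_all _ fun _ => trivial) hg hexp
  · have htop : ∫⁻ a, ENNReal.ofReal (Real.exp (g a)) ∂μ = ∞ := by
      by_contra hne
      exact hexp ((lintegral_ofReal_ne_top_iff_integrable
        (Real.continuous_exp.comp_aestronglyMeasurable hg.1)
        (ae_of_all _ fun _ => (Real.exp_pos _).le)).1 hne)
    exact htop ▸ le_top

lemma integral_threshold_eq {a y : ℝ} (ha : a ∈ Set.Icc (0 : ℝ) 1) :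
    ∫ t in Set.Ioc (0 : ℝ) 1, (if t ≤ a then y else 0) = a * y := by
  have hind : (fun t => if t ≤ a then y else 0) = (Set.Iic a).indicator fun _ => y := rfl
  rw [hind, setIntegral_indicator measurableSet_Iic, Set.Ioc_inter_Iic, min_eq_right ha.2]
  simp [ha.1]

/- By layer cake, the weighted sum is the average over `t ∈ (0, 1]` of the sums over the level sets
`{i | t ≤ a i}`, to which Jensen's inequality applies. -/
lemma ofReal_exp_sum_mul_le_lintegral {ι : Type*} [Fintype ι] {a : ι → ℝ}
    (ha : ∀ i, a i ∈ Set.Icc (0 : ℝ) 1) (y : ι → ℝ) :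
    ENNReal.ofReal (Real.exp (∑ i, a i * y i))
      ≤ ∫⁻ t in Set.Ioc (0 : ℝ) 1, ENNReal.ofReal (Real.exp (∑ i with t ≤ a i, y i)) := by
  have hprob : IsProbabilityMeasure (volume.restrict (Set.Ioc (0 : ℝ) 1)) := ⟨by simp⟩
  have hint (i : ι) : IntegrableOn (fun t => if t ≤ a i then y i else 0) (Set.Ioc (0 : ℝ) 1) :=
    (integrable_const (y i)).indicator measurableSet_Iic
  have hsum : ∑ i, a i * y i = ∫ t in Set.Ioc (0 : ℝ) 1, ∑ i with t ≤ a i, y i := by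
    simp only [Finset.sum_filter]
    rw [integral_finsetSum _ fun i _ => hint i]
    exact Finset.sum_congr rfl fun i _ => (integral_threshold_eq (ha i)).symm
  rw [hsum]
  refine ofReal_exp_integral_le_lintegral ?_
  simp only [Finset.sum_filter]
  exact integrable_finsetSum _ fun i _ => hint i

section RandomSigns

lemma eq_of_minimal_of_isChain {α : Type*} [PartialOrder α] {s : Set α} (hs : IsChain (· ≤ ·) s)
    {P : α → Prop} {a b : α} (ha : Minimal (fun c => c ∈ s ∧ P c) a)
    (hb : Minimal (fun c => c ∈ s ∧ P c) b) : a = b := by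
  rcases hs.total ha.prop.1 hb.prop.1 with h | h
  · exact hb.eq_of_le ha.prop h
  · exact (ha.eq_of_le hb.prop h).symm

lemma minimal_lt_sum_congr {ι : Type*} {𝒜 : Set (Finset ι)} {x : ι → ℝ} {v : ℝ} {ε ε' : ι → ℤˣ}
    {A : Finset ι} (h : ∀ i ∈ A, ε i = ε' i)
    (hA : Minimal (fun B => B ∈ 𝒜 ∧ v < ∑ i ∈ B, ε i • x i) A) :
    Minimal (fun B => B ∈ 𝒜 ∧ v < ∑ i ∈ B, ε' i • x i) A := by
  have hsum {B : Finset ι} (hB : B ⊆ A) : ∑ i ∈ B, ε i • x i = ∑ i ∈ B, ε' i • x i :=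
    Finset.sum_congr rfl fun i hi => by rw [h i (hB hi)]
  refine ⟨⟨hA.prop.1, hsum subset_rfl ▸ hA.prop.2⟩, fun B hB hBA => ?_⟩
  exact hA.le_of_le ⟨hB.1, hsum hBA ▸ hB.2⟩ hBA

variable {ι : Type*} [Fintype ι] [DecidableEq ι]

lemma sum_piecewise_neg_smul (A : Finset ι) (ε : ι → ℤˣ) (x : ι → ℝ) :
    ∑ i, A.piecewise ε (-ε) i • x i = 2 * ∑ i ∈ A, ε i • x i - ∑ i, ε i • x i := by
  have hsub (i : ι) : A.piecewise ε (-ε) i • x i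
      = 2 * (if i ∈ A then ε i • x i else 0) - ε i • x i := by
    by_cases hi : i ∈ A <;> simp [hi, two_mul]
  simp only [hsub, Finset.sum_sub_distrib, ← Finset.mul_sum, Finset.sum_ite_mem,
    Finset.univ_inter]

-- Lévy's reflection: flip every sign outside the first set of the chain whose sum exceeds `v`.
open Classical in
lemma card_exists_lt_sum_le (𝒜 : Set (Finset ι)) (h𝒜 : IsChain (· ⊆ ·) 𝒜) (x : ι → ℝ) (v : ℝ) :
    Finset.card {ε : ι → ℤˣ | ∃ A ∈ 𝒜, v < ∑ i ∈ A, ε i • x i}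
      ≤ 2 * Finset.card {ε : ι → ℤˣ | v < ∑ i, ε i • x i} := by
  set passing : Finset (ι → ℤˣ) := {ε | ∃ A ∈ 𝒜, v < ∑ i ∈ A, ε i • x i}
  set final : Finset (ι → ℤˣ) := {ε | v < ∑ i, ε i • x i}
  have hfirst (ε : ι → ℤˣ) (hε : ε ∈ passing) :
      ∃ A, Minimal (fun B => B ∈ 𝒜 ∧ v < ∑ i ∈ B, ε i • x i) A :=
    exists_minimal_of_wellFoundedLT _ (Finset.mem_filter.1 hε).2
  choose! A hA using hfirst
  let reflect (ε : ι → ℤˣ) : ι → ℤˣ := (A ε).piecewise ε (-ε)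
  have hreflect_min (ε) (hε : ε ∈ passing \ final) :
      Minimal (fun B => B ∈ 𝒜 ∧ v < ∑ i ∈ B, reflect ε i • x i) (A ε) :=
    minimal_lt_sum_congr (fun i hi => (Finset.piecewise_eq_of_mem _ _ _ hi).symm)
      (hA ε (Finset.mem_sdiff.1 hε).1)
  have hreflect_mem : ∀ ε ∈ passing \ final, reflect ε ∈ final := by
    intro ε hε
    obtain ⟨hpass, hfinal⟩ := Finset.mem_sdiff.1 hε
    have hle : ∑ i, ε i • x i ≤ v := by simpa [final] using hfinal
    have hlt := (hA ε hpass).prop.2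
    simp only [final, reflect, Finset.mem_filter, Finset.mem_univ, true_and,
      sum_piecewise_neg_smul]
    linarith
  have hreflect_inj : Set.InjOn reflect ↑(passing \ final) := by
    intro ε hε ε' hε' heq
    have hAA : A ε = A ε' := eq_of_minimal_of_isChain h𝒜 (hreflect_min ε hε)
      (heq ▸ hreflect_min ε' hε')
    ext1 i
    have hi := congrFun heq i
    simp only [reflect, ← hAA] at hi
    by_cases hmem : i ∈ A ε <;> simpa [hmem] using hi
  have hcard : (passing \ final).card ≤ final.card :=
    Finset.card_le_card_of_injOn reflect hreflect_mem hreflect_inj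
  have := Finset.card_le_card_sdiff_add_card (s := passing) (t := final)
  omega

lemma lintegral_ofReal_le_mul_of_measure_lt_le {α : Type*} [MeasurableSpace α] {μ : Measure α}
    {f g : α → ℝ} {C : ℝ≥0∞} (hf : Measurable f) (hf0 : 0 ≤ f) (hg : Measurable g) (hg0 : 0 ≤ g)
    (hC : C ≠ ∞) (h : ∀ t > 0, μ {a | t < f a} ≤ C * μ {a | t < g a}) :
    ∫⁻ a, ENNReal.ofReal (f a) ∂μ ≤ C * ∫⁻ a, ENNReal.ofReal (g a) ∂μ := by
  rw [lintegral_eq_lintegral_meas_lt μ (ae_of_all _ hf0) hf.aemeasurable,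
    lintegral_eq_lintegral_meas_lt μ (ae_of_all _ hg0) hg.aemeasurable,
    ← lintegral_const_mul' C _ hC]
  exact setLIntegral_mono' measurableSet_Ioi h

lemma sum_iSup_exp_sum_le {J : Type*} [Nonempty J] [LinearOrder J] {A : J → Finset ι}
    (hA : Monotone A) (x : ι → ℝ) :
    ∑ ε : ι → ℤˣ, ⨆ j, ENNReal.ofReal (Real.exp (∑ i ∈ A j, ε i • x i))
      ≤ 2 * ∑ ε : ι → ℤˣ, ENNReal.ofReal (Real.exp (∑ i, ε i • x i)) := by
  have hmax (ε : ι → ℤˣ) : ∃ j, ∀ l, ∑ i ∈ A l, ε i • x i ≤ ∑ i ∈ A j, ε i • x i := by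
    obtain ⟨_, ⟨j, rfl⟩, hj⟩ := (Set.range A).toFinite.exists_maximalFor
      (fun B => ∑ i ∈ B, ε i • x i) _ (Set.range_nonempty A)
    exact ⟨j, fun l => le_of_not_gt fun hlt => hlt.not_ge (hj ⟨l, rfl⟩ hlt.le)⟩
  choose j hj using hmax
  have hsup (ε : ι → ℤˣ) : ⨆ l, ENNReal.ofReal (Real.exp (∑ i ∈ A l, ε i • x i))
      ≤ ENNReal.ofReal (Real.exp (∑ i ∈ A (j ε), ε i • x i)) :=
    iSup_le fun l => ENNReal.ofReal_le_ofReal (Real.exp_le_exp.2 (hj ε l))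
  refine (Finset.sum_le_sum fun ε _ => hsup ε).trans ?_
  let : MeasurableSpace (ι → ℤˣ) := ⊤
  have hcake := lintegral_ofReal_le_mul_of_measure_lt_le (μ := Measure.count)
    (f := fun ε : ι → ℤˣ => Real.exp (∑ i ∈ A (j ε), ε i • x i))
    (g := fun ε => Real.exp (∑ i, ε i • x i)) (C := 2) measurable_from_top
    (fun _ => (Real.exp_pos _).le) measurable_from_top (fun _ => (Real.exp_pos _).le)
    ENNReal.ofNat_ne_top fun t ht => by
      simp only [← Real.log_lt_iff_lt_exp ht]
      calc Measure.count {ε : ι → ℤˣ | Real.log t < ∑ i ∈ A (j ε), ε i • x i}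
          ≤ Measure.count {ε : ι → ℤˣ | ∃ B ∈ Set.range A, Real.log t < ∑ i ∈ B, ε i • x i} :=
            measure_mono fun ε hε => ⟨_, ⟨j ε, rfl⟩, hε⟩
        _ ≤ 2 * Measure.count {ε : ι → ℤˣ | Real.log t < ∑ i, ε i • x i} := by
            classical
            rw [Measure.count_apply_finite _ (Set.toFinite _),
              Measure.count_apply_finite _ (Set.toFinite _)]
            have := card_exists_lt_sum_le (Set.range A) hA.isChain_range x (Real.log t)
            simp only [Set.Finite.toFinset_ofPred]
            exact_mod_cast this
  simpa [lintegral_count, tsum_fintype] using hcake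

lemma sum_exp_sum_smul_le (x : ι → ℝ) :
    ∑ ε : ι → ℤˣ, Real.exp (∑ i, ε i • x i)
      ≤ 2 ^ Fintype.card ι * Real.exp ((∑ i, x i ^ 2) / 2) := by
  calc ∑ ε : ι → ℤˣ, Real.exp (∑ i, ε i • x i)
      = ∏ i, ∑ e : ℤˣ, Real.exp (e • x i) := by
        simp only [Finset.prod_univ_sum, Fintype.piFinset_univ, Real.exp_sum]
    _ = ∏ i, 2 * Real.cosh (x i) := by
        refine Finset.prod_congr rfl fun i _ => ?_
        rw [Real.cosh_eq]
        simp only [UnitsInt.univ, Finset.sum_insert (show (1 : ℤˣ) ∉ {-1} by decide),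
          Finset.sum_singleton, one_smul, Units.neg_smul]
        ring
    _ ≤ ∏ i, 2 * Real.exp (x i ^ 2 / 2) := by
        gcongr with i; exact Real.cosh_le_exp_half_sq _
    _ = 2 ^ Fintype.card ι * Real.exp ((∑ i, x i ^ 2) / 2) := by
        rw [Finset.prod_mul_distrib, ← Real.exp_sum, Finset.sum_div, Finset.prod_const,
          Finset.card_univ]

lemma sum_iSup_exp_sum_mul_le {J : Type*} [Countable J] [Nonempty J] [LinearOrder J]
    {a : J → ι → ℝ} (ha : Monotone a) (ha01 : ∀ j i, a j i ∈ Set.Icc (0 : ℝ) 1) (c : ℝ) :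
    ∑ ε : ι → ℤˣ, ⨆ j, ENNReal.ofReal (Real.exp (∑ i, a j i * ε i • c))
      ≤ 2 ^ Fintype.card ι * (2 * ENNReal.ofReal (Real.exp (Fintype.card ι * c ^ 2 / 2))) := by
  let A (t : ℝ) (j : J) : Finset ι := {i | t ≤ a j i}
  have hA (t : ℝ) : Monotone (A t) := fun j l hjl =>
    Finset.monotone_filter_right _ fun i _ hi => le_trans hi (ha hjl i)
  have hmeas (j : J) (ε : ι → ℤˣ) : Measurable fun t => ∑ i ∈ A t j, ε i • c := by
    simp only [A, Finset.sum_filter]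
    exact Finset.measurable_sum _ fun i _ =>
      Measurable.ite measurableSet_Iic measurable_const measurable_const
  calc ∑ ε : ι → ℤˣ, ⨆ j, ENNReal.ofReal (Real.exp (∑ i, a j i * ε i • c))
      ≤ ∑ ε : ι → ℤˣ, ∫⁻ t in Set.Ioc (0 : ℝ) 1,
          ⨆ j, ENNReal.ofReal (Real.exp (∑ i ∈ A t j, ε i • c)) := by
        gcongr with ε
        exact (iSup_mono fun j => ofReal_exp_sum_mul_le_lintegral (ha01 j) _).trans
          (iSup_lintegral_le _)
    _ = ∫⁻ t in Set.Ioc (0 : ℝ) 1,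
          ∑ ε : ι → ℤˣ, ⨆ j, ENNReal.ofReal (Real.exp (∑ i ∈ A t j, ε i • c)) :=
        (lintegral_finsetSum _ fun ε _ => .iSup fun j => (hmeas j ε).exp.ennreal_ofReal).symm
    _ ≤ ∫⁻ _ in Set.Ioc (0 : ℝ) 1,
          2 * ENNReal.ofReal (∑ ε : ι → ℤˣ, Real.exp (∑ i, ε i • c)) := by
        refine lintegral_mono fun t => ?_
        rw [ENNReal.ofReal_sum_of_nonneg fun _ _ => (Real.exp_pos _).le]
        exact sum_iSup_exp_sum_le (hA t) fun _ => c
    _ ≤ 2 * ENNReal.ofReal (2 ^ Fintype.card ι * Real.exp (Fintype.card ι * c ^ 2 / 2)) := by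
        rw [setLIntegral_const, Real.volume_Ioc, sub_zero, ENNReal.ofReal_one, mul_one]
        gcongr
        simpa using sum_exp_sum_smul_le fun _ : ι => c
    _ = 2 ^ Fintype.card ι * (2 * ENNReal.ofReal (Real.exp (Fintype.card ι * c ^ 2 / 2))) := by
        rw [ENNReal.ofReal_mul (by positivity), ENNReal.ofReal_pow zero_le_two,
          ENNReal.ofReal_ofNat, mul_left_comm]

end RandomSigns

section Symmetrization

variable {ι Ω J : Type*} [Fintype ι] [MeasurableSpace Ω] [Countable J] {Q : Measure Ω}
  [IsProbabilityMeasure Q] {f : J → Ω → ℝ}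

lemma integrable_sum_comp_eval {g : Ω → ℝ} (hg : Integrable g Q) :
    Integrable (fun s : ι → Ω => ∑ i, g (s i)) (Measure.pi fun _ => Q) :=
  integrable_finsetSum _ fun _ _ => integrable_comp_eval hg

lemma integral_sum_comp_eval {g : Ω → ℝ} (hg : Integrable g Q) :
    ∫ s : ι → Ω, ∑ i, g (s i) ∂(Measure.pi fun _ => Q) = ∑ _i : ι, ∫ ω, g ω ∂Q := by
  rw [integral_finsetSum _ fun _ _ => integrable_comp_eval hg]
  exact Finset.sum_congr rfl fun i _ => integral_comp_eval hg.1

lemma measurable_iSup_exp_sum {α : Type*} [MeasurableSpace α] {u : J → ι → α → ℝ}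
    (hu : ∀ j i, Measurable (u j i)) :
    Measurable fun a => ⨆ j, ENNReal.ofReal (Real.exp (∑ i, u j i a)) :=
  .iSup fun j => (Finset.measurable_sum _ fun i _ => hu j i).exp.ennreal_ofReal

-- The centring is replaced by an independent ghost sample.
lemma lintegral_iSup_exp_centered_le_ghost (hf : ∀ j, Measurable (f j))
    (hint : ∀ j, Integrable (f j) Q) :
    ∫⁻ s : ι → Ω, ⨆ j, ENNReal.ofReal (Real.exp (∑ i, (f j (s i) - ∫ ω, f j ω ∂Q)))
        ∂(Measure.pi fun _ => Q)
      ≤ ∫⁻ z : ι → Ω × Ω, ⨆ j, ENNReal.ofReal (Real.exp (∑ i, (f j (z i).1 - f j (z i).2)))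
        ∂(Measure.pi fun _ => Q.prod Q) := by
  set μ : Measure (ι → Ω) := Measure.pi fun _ => Q
  have hswap := measurePreserving_arrowProdEquivProdArrow Ω Ω ι (fun _ => Q) fun _ => Q
  have hmeas : Measurable fun z : (ι → Ω) × (ι → Ω) =>
      ⨆ j, ENNReal.ofReal (Real.exp (∑ i, (f j (z.1 i) - f j (z.2 i)))) :=
    measurable_iSup_exp_sum fun j i => by have := hf j; fun_prop
  have hghost (s : ι → Ω) (j : J) :
      ENNReal.ofReal (Real.exp (∑ i, (f j (s i) - ∫ ω, f j ω ∂Q)))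
        ≤ ∫⁻ s', ENNReal.ofReal (Real.exp (∑ i, (f j (s i) - f j (s' i)))) ∂μ := by
    have hsum := integrable_sum_comp_eval (ι := ι) (hint j)
    have hmean : ∑ i, (f j (s i) - ∫ ω, f j ω ∂Q)
        = ∫ s', ∑ i, (f j (s i) - f j (s' i)) ∂μ := by
      simp only [Finset.sum_sub_distrib]
      rw [integral_sub (integrable_const _) hsum, integral_sum_comp_eval (hint j)]
      simp
    rw [hmean]
    refine ofReal_exp_integral_le_lintegral ?_
    simp only [Finset.sum_sub_distrib]
    exact (integrable_const _).sub hsum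
  calc _ ≤ ∫⁻ s, ∫⁻ s', ⨆ j, ENNReal.ofReal (Real.exp (∑ i, (f j (s i) - f j (s' i)))) ∂μ ∂μ :=
        lintegral_mono fun s => (iSup_mono (hghost s)).trans (iSup_lintegral_le _)
    _ = _ := by rw [← lintegral_prod _ hmeas.aemeasurable, ← hswap.lintegral_comp hmeas]; rfl

lemma measurePreserving_signed_swap (ε : ι → ℤˣ) :
    MeasurePreserving (fun (z : ι → Ω × Ω) i => if ε i = 1 then z i else (z i).swap)
      (Measure.pi fun _ => Q.prod Q) (Measure.pi fun _ => Q.prod Q) := by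
  refine measurePreserving_pi (f := fun i (p : Ω × Ω) => if ε i = 1 then p else p.swap) _ _
    fun i => ?_
  by_cases h : ε i = 1
  · simp only [h, if_true]
    exact MeasurePreserving.id _
  · simpa [h] using Measure.measurePreserving_swap

lemma ofReal_exp_sub_le (x y : ℝ) : ENNReal.ofReal (Real.exp (x - y)) ≤
    2⁻¹ * (ENNReal.ofReal (Real.exp (2 * x)) + ENNReal.ofReal (Real.exp (-(2 * y)))) := by
  have hx : Real.exp (2 * x) = Real.exp x ^ 2 := by rw [← Real.exp_nat_mul]; simp
  have hy : Real.exp (-(2 * y)) = Real.exp (-y) ^ 2 := by rw [← Real.exp_nat_mul]; simp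
  have h2 : (2⁻¹ : ℝ≥0∞) = ENNReal.ofReal 2⁻¹ := by
    rw [ENNReal.ofReal_inv_of_pos two_pos, ENNReal.ofReal_ofNat]
  rw [h2, ← ENNReal.ofReal_add (Real.exp_pos _).le (Real.exp_pos _).le,
    ← ENNReal.ofReal_mul (by norm_num)]
  refine ENNReal.ofReal_le_ofReal ?_
  rw [sub_eq_add_neg, Real.exp_add, hx, hy]
  linarith [two_mul_le_add_sq (Real.exp x) (Real.exp (-y))]

lemma lintegral_iSup_exp_signed_sub_le (hf : ∀ j, Measurable (f j)) (ε : ι → ℤˣ) :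
    ∫⁻ z : ι → Ω × Ω, ⨆ j, ENNReal.ofReal (Real.exp (∑ i, ε i • (f j (z i).1 - f j (z i).2)))
        ∂(Measure.pi fun _ => Q.prod Q)
      ≤ 2⁻¹ * (∫⁻ s : ι → Ω, ⨆ j, ENNReal.ofReal (Real.exp (∑ i, 2 * ε i • f j (s i)))
            ∂(Measure.pi fun _ => Q)
          + ∫⁻ s : ι → Ω, ⨆ j, ENNReal.ofReal (Real.exp (∑ i, 2 * (-ε) i • f j (s i)))
            ∂(Measure.pi fun _ => Q)) := by
  have hmeas (ε : ι → ℤˣ) : Measurable fun s : ι → Ω =>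
      ⨆ j, ENNReal.ofReal (Real.exp (∑ i, 2 * ε i • f j (s i))) :=
    measurable_iSup_exp_sum fun j i => by have := hf j; fun_prop
  have hfst : MeasurePreserving (fun (z : ι → Ω × Ω) i => (z i).1)
      (Measure.pi fun _ => Q.prod Q) (Measure.pi fun _ => Q) :=
    measurePreserving_pi _ _ fun _ => measurePreserving_fst
  have hsnd : MeasurePreserving (fun (z : ι → Ω × Ω) i => (z i).2)
      (Measure.pi fun _ => Q.prod Q) (Measure.pi fun _ => Q) :=
    measurePreserving_pi _ _ fun _ => measurePreserving_snd
  rw [← hfst.lintegral_comp (hmeas ε), ← hsnd.lintegral_comp (hmeas (-ε))]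
  refine le_of_le_of_eq ?_
    (congrArg (2⁻¹ * ·) (lintegral_add_left ((hmeas ε).comp hfst.measurable) _))
  rw [← lintegral_const_mul' _ _ (by simp)]
  refine lintegral_mono fun z => iSup_le fun j => ?_
  simp only [smul_sub, Finset.sum_sub_distrib, Pi.neg_apply, Units.neg_smul, mul_neg,
    Finset.sum_neg_distrib, ← Finset.mul_sum]
  refine (ofReal_exp_sub_le _ _).trans ?_
  gcongr
  · exact le_iSup (fun j => ENNReal.ofReal (Real.exp (2 * ∑ i, ε i • f j (z i).1))) j
  · exact le_iSup (fun j => ENNReal.ofReal (Real.exp (-(2 * ∑ i, ε i • f j (z i).2)))) j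

lemma two_pow_mul_lintegral_iSup_exp_centered_le [DecidableEq ι] (hf : ∀ j, Measurable (f j))
    (hint : ∀ j, Integrable (f j) Q) :
    2 ^ Fintype.card ι *
        ∫⁻ s : ι → Ω, ⨆ j, ENNReal.ofReal (Real.exp (∑ i, (f j (s i) - ∫ ω, f j ω ∂Q)))
          ∂(Measure.pi fun _ => Q)
      ≤ ∑ ε : ι → ℤˣ, ∫⁻ s : ι → Ω, ⨆ j, ENNReal.ofReal (Real.exp (∑ i, 2 * ε i • f j (s i)))
          ∂(Measure.pi fun _ => Q) := by
  set Φ : (ι → ℤˣ) → ℝ≥0∞ := fun ε => ∫⁻ s : ι → Ω,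
    ⨆ j, ENNReal.ofReal (Real.exp (∑ i, 2 * ε i • f j (s i))) ∂(Measure.pi fun _ => Q)
  have hmeas : Measurable fun z : ι → Ω × Ω =>
      ⨆ j, ENNReal.ofReal (Real.exp (∑ i, (f j (z i).1 - f j (z i).2))) :=
    measurable_iSup_exp_sum fun j i => by have := hf j; fun_prop
  have hswap (ε : ι → ℤˣ) (z : ι → Ω × Ω) (j : J) (i : ι) :
      f j (if ε i = 1 then z i else (z i).swap).1 - f j (if ε i = 1 then z i else (z i).swap).2
        = ε i • (f j (z i).1 - f j (z i).2) := by
    rcases Int.units_eq_one_or (ε i) with h | h <;> simp [h, Units.neg_smul]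
  have hsigned (ε : ι → ℤˣ) :
      ∫⁻ s : ι → Ω, ⨆ j, ENNReal.ofReal (Real.exp (∑ i, (f j (s i) - ∫ ω, f j ω ∂Q)))
        ∂(Measure.pi fun _ => Q) ≤ 2⁻¹ * (Φ ε + Φ (-ε)) := by
    refine (lintegral_iSup_exp_centered_le_ghost hf hint).trans ?_
    rw [← (measurePreserving_signed_swap ε).lintegral_comp hmeas]
    simp only [hswap]
    exact lintegral_iSup_exp_signed_sub_le hf ε
  have hcard : (2 : ℝ≥0∞) ^ Fintype.card ι = (Fintype.card (ι → ℤˣ) : ℝ≥0∞) := by simp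
  have hneg : ∑ ε, Φ (-ε) = ∑ ε, Φ ε := Equiv.sum_comp (Equiv.neg (ι → ℤˣ)) Φ
  calc _ ≤ ∑ ε, 2⁻¹ * (Φ ε + Φ (-ε)) := by
        rw [hcard, ← nsmul_eq_mul]
        exact Finset.card_nsmul_le_sum _ _ _ fun ε _ => hsigned ε
    _ = ∑ ε, Φ ε := by
        rw [← Finset.mul_sum, Finset.sum_add_distrib, hneg, ← two_mul,
          ← mul_assoc, ENNReal.inv_mul_cancel two_ne_zero ENNReal.ofNat_ne_top, one_mul]

end Symmetrization

section UniformDeviation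

variable {ι Ω : Type*} [Fintype ι] [MeasurableSpace Ω] {Q : Measure Ω} [IsProbabilityMeasure Q]

section Countable

variable {J : Type*} [Countable J] [LinearOrder J] {f : J → Ω → ℝ}

lemma integrable_of_mem_Icc {g : Ω → ℝ} {a b : ℝ} (hg : Measurable g)
    (hab : ∀ ω, g ω ∈ Set.Icc a b) : Integrable g Q :=
  .of_mem_Icc a b hg.aemeasurable (ae_of_all _ hab)

lemma lintegral_iSup_exp_mul_centered_le [Nonempty J] (hf : ∀ j, Measurable (f j))
    (hmono : Monotone f) (h01 : ∀ j ω, f j ω ∈ Set.Icc (0 : ℝ) 1) (c : ℝ) :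
    ∫⁻ s : ι → Ω, ⨆ j, ENNReal.ofReal (Real.exp (∑ i, c * (f j (s i) - ∫ ω, f j ω ∂Q)))
        ∂(Measure.pi fun _ => Q)
      ≤ 2 * ENNReal.ofReal (Real.exp (2 * Fintype.card ι * c ^ 2)) := by
  classical
  have hsym := two_pow_mul_lintegral_iSup_exp_centered_le (ι := ι) (Q := Q)
    (f := fun j ω => c * f j ω) (fun j => (hf j).const_mul c)
    fun j => (integrable_of_mem_Icc (hf j) (h01 j)).const_mul c
  simp only [integral_const_mul, ← mul_sub] at hsym
  have hsign (s : ι → Ω) : ∑ ε : ι → ℤˣ,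
      ⨆ j, ENNReal.ofReal (Real.exp (∑ i, 2 * ε i • (c * f j (s i))))
        ≤ 2 ^ Fintype.card ι * (2 * ENNReal.ofReal (Real.exp (2 * Fintype.card ι * c ^ 2))) := by
    have hsigned := sum_iSup_exp_sum_mul_le (a := fun j i => f j (s i))
      (fun j l hjl i => hmono hjl (s i)) (fun j i => h01 j (s i)) (2 * c)
    have harg (ε : ι → ℤˣ) (j : J) (i : ι) :
        2 * ε i • (c * f j (s i)) = f j (s i) * ε i • (2 * c) := by
      simp only [Units.smul_def, zsmul_eq_mul]; ring
    have hexp : (Fintype.card ι : ℝ) * (2 * c) ^ 2 / 2 = 2 * Fintype.card ι * c ^ 2 := by ring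
    simpa only [harg, hexp] using hsigned
  have hmeas (ε : ι → ℤˣ) : Measurable fun s : ι → Ω =>
      ⨆ j, ENNReal.ofReal (Real.exp (∑ i, 2 * ε i • (c * f j (s i)))) :=
    measurable_iSup_exp_sum fun j i => by have := hf j; fun_prop
  rw [← lintegral_finsetSum _ fun ε _ => hmeas ε] at hsym
  have hle := hsym.trans (lintegral_mono hsign)
  rw [lintegral_const, measure_univ, mul_one] at hle
  exact (ENNReal.mul_le_mul_iff_right (by simp) (by simp)).1 hle

lemma measure_exists_lt_abs_sum_centered_le_of_countable (hf : ∀ j, Measurable (f j))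
    (hmono : Monotone f) (h01 : ∀ j ω, f j ω ∈ Set.Icc (0 : ℝ) 1) {u : ℝ} (hu : 0 ≤ u) :
    (Measure.pi fun _ : ι => Q)
        {s | ∃ j, (Fintype.card ι : ℝ) * u < |∑ i, (f j (s i) - ∫ ω, f j ω ∂Q)|}
      ≤ 4 * ENNReal.ofReal (Real.exp (-(Fintype.card ι * u ^ 2 / 8))) := by
  rcases isEmpty_or_nonempty J with _ | _
  · simp
  set μ : Measure (ι → Ω) := Measure.pi fun _ => Q
  set n := (Fintype.card ι : ℝ)
  have hchernoff (c : ℝ) (hc : c ^ 2 = (u / 4) ^ 2) :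
      μ {s | ∃ j, n * u * (u / 4) ≤ ∑ i, c * (f j (s i) - ∫ ω, f j ω ∂Q)}
        ≤ 2 * ENNReal.ofReal (Real.exp (-(n * u ^ 2 / 8))) := by
    have hmeas : Measurable fun s : ι → Ω =>
        ⨆ j, ENNReal.ofReal (Real.exp (∑ i, c * (f j (s i) - ∫ ω, f j ω ∂Q))) :=
      measurable_iSup_exp_sum fun j i => by have := hf j; fun_prop
    set t := ENNReal.ofReal (Real.exp (n * u * (u / 4)))
    have hexp : t * (2 * ENNReal.ofReal (Real.exp (-(n * u ^ 2 / 8))))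
        = 2 * ENNReal.ofReal (Real.exp (2 * n * c ^ 2)) := by
      rw [mul_left_comm, ← ENNReal.ofReal_mul (Real.exp_pos _).le, ← Real.exp_add, hc]
      ring_nf
    have hmarkov := (mul_meas_ge_le_lintegral (μ := μ) hmeas t).trans
      ((lintegral_iSup_exp_mul_centered_le hf hmono h01 c).trans_eq hexp.symm)
    have ht : t ≠ 0 := by simp [t, Real.exp_pos]
    refine (measure_mono ?_).trans
      ((ENNReal.mul_le_mul_iff_right ht ENNReal.ofReal_ne_top).1 hmarkov)
    rintro s ⟨j, hj⟩
    exact (ENNReal.ofReal_le_ofReal (Real.exp_le_exp.2 hj)).trans (le_iSup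
      (fun j => ENNReal.ofReal (Real.exp (∑ i, c * (f j (s i) - ∫ ω, f j ω ∂Q)))) j)
  have hsplit : {s : ι → Ω | ∃ j, n * u < |∑ i, (f j (s i) - ∫ ω, f j ω ∂Q)|}
      ⊆ {s | ∃ j, n * u * (u / 4) ≤ ∑ i, u / 4 * (f j (s i) - ∫ ω, f j ω ∂Q)}
        ∪ {s | ∃ j, n * u * (u / 4) ≤ ∑ i, -(u / 4) * (f j (s i) - ∫ ω, f j ω ∂Q)} := by
    rintro s ⟨j, hj⟩
    simp only [← Finset.mul_sum]
    rcases lt_abs.1 hj with h | h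
    · exact .inl ⟨j, by nlinarith⟩
    · exact .inr ⟨j, by nlinarith⟩
  calc _ ≤ _ := (measure_mono hsplit).trans (measure_union_le _ _)
    _ ≤ _ := add_le_add (hchernoff _ rfl) (hchernoff _ (neg_sq _))
    _ = _ := by rw [← add_mul]; norm_num

end Countable

lemma exists_mem_range_ratCast_or_not_continuousAt {m : ℝ → ℝ} {u : ℝ} (hu : 0 < u) (η : ℝ) :
    let J := Set.range ((↑) : ℚ → ℝ) ∪ {η | ¬ ContinuousAt m η}
    (∃ q ∈ J, η ≤ q ∧ m q < m η + u) ∧ ∃ q ∈ J, q ≤ η ∧ m η - u < m q := by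
  intro J
  by_cases hη : ContinuousAt m η
  · have habove : ∀ᶠ q in 𝓝[>] η, m q < m η + u :=
      nhdsWithin_le_nhds (hη.eventually_lt_const (by linarith))
    have hbelow : ∀ᶠ q in 𝓝[<] η, m η - u < m q :=
      nhdsWithin_le_nhds (hη.eventually_const_lt (by linarith))
    obtain ⟨b, hb, hηb⟩ := mem_nhdsGT_iff_exists_Ioo_subset.1 habove
    obtain ⟨a, ha, haη⟩ := mem_nhdsLT_iff_exists_Ioo_subset.1 hbelow
    obtain ⟨q, hq⟩ := exists_rat_btwn (Set.mem_Ioi.1 hb)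
    obtain ⟨r, hr⟩ := exists_rat_btwn (Set.mem_Iio.1 ha)
    exact ⟨⟨q, .inl ⟨q, rfl⟩, hq.1.le, hηb hq⟩, ⟨r, .inl ⟨r, rfl⟩, hr.2.le, haη hr⟩⟩
  · exact ⟨⟨η, .inr hη, le_rfl, by linarith⟩, ⟨η, .inr hη, le_rfl, by linarith⟩⟩

lemma measure_exists_lt_abs_sum_centered_le_of_mem_Icc [Nonempty ι] {f : ℝ → Ω → ℝ}
    (hf : ∀ η, Measurable (f η)) (hmono : Monotone f) (h01 : ∀ η ω, f η ω ∈ Set.Icc (0 : ℝ) 1)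
    {u : ℝ} (hu : 0 < u) :
    (Measure.pi fun _ : ι => Q)
        {s | ∃ η, (Fintype.card ι : ℝ) * u < |∑ i, (f η (s i) - ∫ ω, f η ω ∂Q)|}
      ≤ 4 * ENNReal.ofReal (Real.exp (-(Fintype.card ι * u ^ 2 / 32))) := by
  set m : ℝ → ℝ := fun η => ∫ ω, f η ω ∂Q
  have hm : Monotone m := fun η η' h => integral_mono (integrable_of_mem_Icc (hf η) (h01 η))
    (integrable_of_mem_Icc (hf η') (h01 η')) (hmono h)
  let J : Set ℝ := Set.range ((↑) : ℚ → ℝ) ∪ {η | ¬ ContinuousAt m η}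
  have : Countable J := ((Set.countable_range _).union hm.countable_not_continuousAt).to_subtype
  have hcard : (0 : ℝ) < Fintype.card ι := by exact_mod_cast Fintype.card_pos
  have hskeleton : {s : ι → Ω | ∃ η, (Fintype.card ι : ℝ) * u < |∑ i, (f η (s i) - m η)|}
      ⊆ {s | ∃ q : J, (Fintype.card ι : ℝ) * (u / 2) < |∑ i, (f q (s i) - m q)|} := by
    rintro s ⟨η, hη⟩
    simp only [Finset.sum_sub_distrib, Finset.sum_const, Finset.card_univ, nsmul_eq_mul,
      Set.mem_ofPred_eq] at hη ⊢
    have hsum {a b : ℝ} (hab : a ≤ b) : ∑ i, f a (s i) ≤ ∑ i, f b (s i) :=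
      Finset.sum_le_sum fun i _ => hmono hab (s i)
    obtain ⟨⟨q, hqJ, hηq, hmq⟩, r, hrJ, hrη, hmr⟩ :=
      exists_mem_range_ratCast_or_not_continuousAt (m := m) (half_pos hu) η
    rcases lt_abs.1 hη with h | h
    · exact ⟨⟨q, hqJ⟩, lt_abs.2 (.inl (by linarith [hsum hηq, mul_lt_mul_of_pos_left hmq hcard]))⟩
    · exact ⟨⟨r, hrJ⟩, lt_abs.2 (.inr (by linarith [hsum hrη, mul_lt_mul_of_pos_left hmr hcard]))⟩
  refine (measure_mono hskeleton).trans ((measure_exists_lt_abs_sum_centered_le_of_countable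
    (f := fun q : J => f q) (fun q => hf q) (fun _ _ h => hmono h) (fun q => h01 q)
    (half_pos hu).le).trans_eq ?_)
  ring_nf

lemma measure_exists_lt_abs_sum_centered_le [Nonempty ι] {f : ℝ → Ω → ℝ}
    (hf : ∀ η, Measurable (f η)) (hmono : Monotone f) {B : ℝ} (hB : 0 < B)
    (hfB : ∀ η ω, |f η ω| ≤ B) {u : ℝ} (hu : 0 < u) :
    (Measure.pi fun _ : ι => Q)
        {s | ∃ η, (Fintype.card ι : ℝ) * (B * u) < |∑ i, (f η (s i) - ∫ ω, f η ω ∂Q)|}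
      ≤ 4 * ENNReal.ofReal (Real.exp (-(Fintype.card ι * u ^ 2 / 128))) := by
  let g (η : ℝ) (ω : Ω) : ℝ := (f η ω + B) / (2 * B)
  have hg01 (η : ℝ) (ω : Ω) : g η ω ∈ Set.Icc (0 : ℝ) 1 := by
    obtain ⟨hlo, hhi⟩ := abs_le.1 (hfB η ω)
    exact ⟨div_nonneg (by linarith) (by linarith), (div_le_one (by linarith)).2 (by linarith)⟩
  have hcentered (η : ℝ) (ω : Ω) :
      g η ω - ∫ ω, g η ω ∂Q = (f η ω - ∫ ω, f η ω ∂Q) / (2 * B) := by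
    have hint : Integrable (f η) Q :=
      integrable_of_mem_Icc (hf η) fun ω => abs_le.1 (hfB η ω)
    simp only [g]
    rw [integral_div, integral_add hint (integrable_const _)]
    simp only [integral_const, probReal_univ, one_smul]
    ring
  have hg := measure_exists_lt_abs_sum_centered_le_of_mem_Icc (ι := ι) (Q := Q) (f := g)
    (fun η => ((hf η).add_const B).div_const _)
    (fun η η' h ω => by simp only [g]; gcongr; exact hmono h ω) hg01 (half_pos hu)
  simp only [hcentered, ← Finset.sum_div, abs_div, abs_of_pos (mul_pos two_pos hB)] at hg
  have hlevel (η : ℝ) (s : ι → Ω) :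
      (Fintype.card ι : ℝ) * (u / 2) < |∑ i, (f η (s i) - ∫ ω, f η ω ∂Q)| / (2 * B)
        ↔ (Fintype.card ι : ℝ) * (B * u) < |∑ i, (f η (s i) - ∫ ω, f η ω ∂Q)| := by
    rw [lt_div_iff₀ (by positivity)]
    exact iff_of_eq (congrArg (· < _) (by ring))
  have hrate : (Fintype.card ι : ℝ) * (u / 2) ^ 2 / 32 = Fintype.card ι * u ^ 2 / 128 := by ring
  simpa only [hlevel, hrate] using hg

end UniformDeviation

section Measurability

variable {k : ℕ}

lemma measurable_D : Measurable (D (k := k)) := measurable_snd.comp measurable_XD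

lemma measurable_R : Measurable (R (k := k)) :=
  measurable_snd.comp (measurable_snd.comp (measurable_snd.comp measurable_snd))

lemma measurable_Y1 : Measurable (Y1 (k := k)) := measurable_fst.comp measurable_snd

lemma measurable_Y0 : Measurable (Y0 (k := k)) :=
  measurable_fst.comp (measurable_snd.comp measurable_snd)

lemma measurable_potential : Measurable (potential (k := k)) :=
  measurable_Y1.prodMk measurable_Y0

lemma measurable_Yobs : Measurable (Yobs (k := k)) :=
  Measurable.ite (measurable_D (measurableSet_singleton true)) measurable_Y1 measurable_Y0

lemma measurable_apply_bool {α : Type*} [MeasurableSpace α] {g : Bool → α → ℝ} {d : α → Bool}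
    (hg : ∀ b, Measurable (g b)) (hd : Measurable d) : Measurable fun a => g (d a) a :=
  (measurable_from_prod_countable_right hg : Measurable fun p : Bool × α => g p.1 p.2).comp
    (hd.prodMk measurable_id)

/-- The part of `MeasurableFit` that concerns a single realization of the training data: the score
is a random variable and, for each `η`, the nuisance estimates are measurable functions of
`(x, d)`. -/
structure Fit.IsMeasurable (F : Fit k) : Prop where
  score : Measurable F.score
  mHat : ∀ η, Measurable fun p : Cov k × Bool => F.mHat η p.1 p.2
  piHat : Measurable fun p : Cov k × Bool => F.piHat p.1 p.2

namespace MeasurableFit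

variable {𝒯 : Type*} [MeasurableSpace 𝒯] {L : 𝒯 → Fit k}

lemma measurable_score (hL : MeasurableFit L) :
    Measurable fun p : 𝒯 × Obs k => (L p.1).score p.2 := by
  have hX : Measurable fun p : 𝒯 × Obs k => (p.1, X p.2) :=
    measurable_fst.prodMk (measurable_X.comp measurable_snd)
  have hY : Measurable fun p : 𝒯 × Obs k => Yobs p.2 := measurable_Yobs.comp measurable_snd
  have hD : MeasurableSet {p : 𝒯 × Obs k | D p.2 = true} :=
    (measurable_D.comp measurable_snd) (measurableSet_singleton true)
  have hcL : Measurable fun p : 𝒯 × Obs k => (L p.1).cL p.2 :=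
    Measurable.ite hD (hY.sub ((hL.upper false).comp hX)) (((hL.lower true).comp hX).sub hY)
  have hcR : Measurable fun p : 𝒯 × Obs k => (L p.1).cR p.2 :=
    Measurable.ite hD (hY.sub ((hL.lower false).comp hX)) (((hL.upper true).comp hX).sub hY)
  exact ((hL.hL.comp hX).sub hcL).max (hcR.sub (hL.hR.comp hX))

lemma isMeasurable (hL : MeasurableFit L) (t : 𝒯) : (L t).IsMeasurable where
  score := hL.measurable_score.comp measurable_prodMk_left
  mHat η := measurable_apply_bool (g := fun b p => (L t).mHat η p.1 b)
    (fun b => (hL.mHat b).comp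
      (measurable_const.prodMk (measurable_const.prodMk measurable_fst))) measurable_snd
  piHat := measurable_apply_bool (g := fun b p => (L t).piHat p.1 b)
    (fun b => (hL.piHat b).comp (measurable_const.prodMk measurable_fst)) measurable_snd

end MeasurableFit

namespace Fit.IsMeasurable

variable {F : Fit k}

lemma measurableSet_score_lt (hF : F.IsMeasurable) (η : ℝ) : MeasurableSet {o | F.score o < η} :=
  measurableSet_lt hF.score measurable_const

lemma measurable_mHat (hF : F.IsMeasurable) (η : ℝ) :
    Measurable fun o : Obs k => F.mHat η (X o) (D o) :=
  (hF.mHat η).comp measurable_XD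

lemma measurable_piHat (hF : F.IsMeasurable) : Measurable fun o : Obs k => F.piHat (X o) (D o) :=
  hF.piHat.comp measurable_XD

end Fit.IsMeasurable

end Measurability

section InfluenceFunction

variable {k : ℕ} {F : Fit k} {γ m₀ π₀ : ℝ}

namespace Fit

variable (F)

/-- The inverse odds weight `R / π̂_R(X, D)` of the influence function; it may be negative, because
only `|π̂_R|` is bounded below. -/
noncomputable def weight (o : Obs k) : ℝ := if R o then (F.piHat (X o) (D o))⁻¹ else 0

/-- The indicator `1{V_C < η}`. -/
noncomputable def belowIndicator (η : ℝ) : Obs k → ℝ := {o | F.score o < η}.indicator fun _ => 1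

/-- The terms of `psi` that increase with `η`; see `psi_eq_psiPos_sub_psiNeg`. -/
noncomputable def psiPos (η : ℝ) (o : Obs k) : ℝ :=
  (if R o then 0 else F.mHat η (X o) (D o))
    + ((F.weight o)⁺ * F.belowIndicator η o + (F.weight o)⁻ * F.mHat η (X o) (D o))

/-- Minus the terms of `psi` that decrease with `η`; see `psi_eq_psiPos_sub_psiNeg`. -/
noncomputable def psiNeg (γ η : ℝ) (o : Obs k) : ℝ :=
  (if R o then 0 else 1 - γ)
    + ((F.weight o)⁺ * F.mHat η (X o) (D o) + (F.weight o)⁻ * F.belowIndicator η o)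

lemma psi_eq (γ η : ℝ) (o : Obs k) :
    F.psi γ η o = (if R o then 0 else F.mHat η (X o) (D o) - (1 - γ))
      + F.weight o * (F.belowIndicator η o - F.mHat η (X o) (D o)) := by
  cases hR : R o <;> simp [psi, weight, belowIndicator, hR, Set.indicator_apply]

lemma psi_eq_psiPos_sub_psiNeg (γ η : ℝ) (o : Obs k) :
    F.psi γ η o = F.psiPos η o - F.psiNeg γ η o := by
  have hw := posPart_sub_negPart (F.weight o)
  rw [psi_eq, psiPos, psiNeg]
  split_ifs <;>
    linear_combination (F.mHat η (X o) (D o) - F.belowIndicator η o) * hw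

lemma monotone_belowIndicator : Monotone F.belowIndicator := fun _ _ hη _ =>
  Set.indicator_le_indicator_of_subset (fun _ hV => lt_of_lt_of_le hV hη) (fun _ => zero_le_one) _

lemma belowIndicator_nonneg (η : ℝ) (o : Obs k) : 0 ≤ F.belowIndicator η o :=
  Set.indicator_nonneg (fun _ _ => zero_le_one) _

lemma belowIndicator_le_one (η : ℝ) (o : Obs k) : F.belowIndicator η o ≤ 1 :=
  Set.indicator_le_self' (fun _ _ => zero_le_one) _

end Fit

lemma abs_posPart_mul_add_negPart_mul_le {w a b C : ℝ} (ha : |a| ≤ C) (hb : |b| ≤ C) :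
    |w⁺ * a + w⁻ * b| ≤ |w| * C := by
  calc |w⁺ * a + w⁻ * b| ≤ w⁺ * |a| + w⁻ * |b| := by
        refine (abs_add_le _ _).trans_eq ?_
        rw [abs_mul, abs_mul, abs_of_nonneg (posPart_nonneg w), abs_of_nonneg (negPart_nonneg w)]
    _ ≤ w⁺ * C + w⁻ * C := by
        gcongr
    _ = |w| * C := by rw [← add_mul, posPart_add_negPart]

lemma eight_mul_exp_neg_le {L : ℝ} (hL : 0 ≤ L) :
    8 * Real.exp (-(25 / 8 * (L + 1))) ≤ Real.exp (-L) := by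
  have h8 : (8 : ℝ) ≤ Real.exp 3 := by
    have := pow_le_pow_left₀ (by norm_num) Real.exp_one_gt_d9.le 3
    rw [← Real.exp_nat_mul] at this
    norm_num at this ⊢
    linarith
  calc 8 * Real.exp (-(25 / 8 * (L + 1))) ≤ Real.exp 3 * Real.exp (-(L + 3)) := by
        gcongr
        linarith
    _ = Real.exp (-L) := by rw [← Real.exp_add]; ring_nf

namespace Fit

lemma IsMeasurable.measurable_weight (hF : F.IsMeasurable) : Measurable F.weight :=
  Measurable.ite (measurable_R (measurableSet_singleton true)) hF.measurable_piHat.inv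
    measurable_const

lemma IsMeasurable.measurable_belowIndicator (hF : F.IsMeasurable) (η : ℝ) :
    Measurable (F.belowIndicator η) :=
  measurable_const.indicator (hF.measurableSet_score_lt η)

lemma IsMeasurable.measurable_psiPos (hF : F.IsMeasurable) (η : ℝ) : Measurable (F.psiPos η) :=
  (Measurable.ite (measurable_R (measurableSet_singleton true)) measurable_const
    (hF.measurable_mHat η)).add
    (((measurable_posPart.comp hF.measurable_weight).mul (hF.measurable_belowIndicator η)).add
      ((measurable_negPart.comp hF.measurable_weight).mul (hF.measurable_mHat η)))

lemma IsMeasurable.measurable_psiNeg (hF : F.IsMeasurable) (γ η : ℝ) :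
    Measurable (F.psiNeg γ η) :=
  (Measurable.ite (measurable_R (measurableSet_singleton true)) measurable_const
    measurable_const).add
    (((measurable_posPart.comp hF.measurable_weight).mul (hF.measurable_mHat η)).add
      ((measurable_negPart.comp hF.measurable_weight).mul (hF.measurable_belowIndicator η)))

namespace Regular

lemma nonneg (hreg : F.Regular m₀ π₀) : 0 ≤ m₀ := (abs_nonneg _).trans (hreg.bound 0 0 true)

lemma monotone_psiPos (hreg : F.Regular m₀ π₀) : Monotone F.psiPos := by
  intro η η' hη o
  have hm := hreg.mono (X o) (D o) hη
  refine add_le_add ?_ (add_le_add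
    (mul_le_mul_of_nonneg_left (F.monotone_belowIndicator hη o) (posPart_nonneg _))
    (mul_le_mul_of_nonneg_left hm (negPart_nonneg _)))
  split_ifs
  exacts [le_rfl, hm]

lemma monotone_psiNeg (hreg : F.Regular m₀ π₀) (γ : ℝ) : Monotone (F.psiNeg γ) := by
  intro η η' hη o
  exact add_le_add_right (add_le_add
    (mul_le_mul_of_nonneg_left (hreg.mono (X o) (D o) hη) (posPart_nonneg _))
    (mul_le_mul_of_nonneg_left (F.monotone_belowIndicator hη o) (negPart_nonneg _))) _

lemma abs_inv_piHat_le (hreg : F.Regular m₀ π₀) (hπ : 0 < π₀) (o : Obs k) :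
    |(F.piHat (X o) (D o))⁻¹| ≤ π₀⁻¹ := by
  rw [abs_inv]
  exact inv_anti₀ hπ (hreg.lower _ _)

lemma abs_weight_le (hreg : F.Regular m₀ π₀) (hπ : 0 < π₀) (o : Obs k) :
    |F.weight o| ≤ π₀⁻¹ := by
  rw [Fit.weight]
  split_ifs
  · exact hreg.abs_inv_piHat_le hπ o
  · exact abs_zero.trans_le (inv_nonneg.mpr hπ.le)

lemma abs_mHat_le (hreg : F.Regular m₀ π₀) (η : ℝ) (o : Obs k) :
    |F.mHat η (X o) (D o)| ≤ 1 + m₀ :=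
  (hreg.bound _ _ _).trans (le_add_of_nonneg_left zero_le_one)

lemma abs_belowIndicator_le (hreg : F.Regular m₀ π₀) (η : ℝ) (o : Obs k) :
    |F.belowIndicator η o| ≤ 1 + m₀ := by
  rw [abs_of_nonneg (F.belowIndicator_nonneg η o)]
  exact (F.belowIndicator_le_one η o).trans (le_add_of_nonneg_right hreg.nonneg)

-- On `R = 0` the weight vanishes, and on `R = 1` only the weighted terms remain.
lemma abs_ite_add_le (hreg : F.Regular m₀ π₀) (hπ : 0 < π₀) (hπ1 : π₀ ≤ 1) {o : Obs k}
    {c a b : ℝ} (hc : |c| ≤ 1 + m₀) (ha : |a| ≤ 1 + m₀) (hb : |b| ≤ 1 + m₀) :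
    |(if R o then 0 else c) + ((F.weight o)⁺ * a + (F.weight o)⁻ * b)| ≤ π₀⁻¹ * (1 + m₀) := by
  have hm : 0 ≤ 1 + m₀ := (abs_nonneg c).trans hc
  cases hR : R o
  · simpa [Fit.weight, hR] using hc.trans (le_mul_of_one_le_left hm ((one_le_inv₀ hπ).mpr hπ1))
  · simpa only [if_true, zero_add] using (abs_posPart_mul_add_negPart_mul_le ha hb).trans
      (mul_le_mul_of_nonneg_right (hreg.abs_weight_le hπ o) hm)

lemma abs_psiPos_le (hreg : F.Regular m₀ π₀) (hπ : 0 < π₀) (hπ1 : π₀ ≤ 1) (η : ℝ) (o : Obs k) :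
    |F.psiPos η o| ≤ π₀⁻¹ * (1 + m₀) :=
  hreg.abs_ite_add_le hπ hπ1 (hreg.abs_mHat_le η o) (hreg.abs_belowIndicator_le η o)
    (hreg.abs_mHat_le η o)

lemma abs_psiNeg_le (hreg : F.Regular m₀ π₀) (hπ : 0 < π₀) (hπ1 : π₀ ≤ 1) (hγ0 : 0 ≤ γ)
    (hγ1 : γ ≤ 1) (η : ℝ) (o : Obs k) : |F.psiNeg γ η o| ≤ π₀⁻¹ * (1 + m₀) := by
  have hγ : |1 - γ| ≤ 1 + m₀ := by
    rw [abs_of_nonneg (sub_nonneg.mpr hγ1)]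
    linarith [hreg.nonneg]
  exact hreg.abs_ite_add_le hπ hπ1 hγ (hreg.abs_mHat_le η o) (hreg.abs_belowIndicator_le η o)

end Regular

variable {Q : Measure (Obs k)} [IsProbabilityMeasure Q]

lemma IsMeasurable.integrable_psiPos (hF : F.IsMeasurable) (hreg : F.Regular m₀ π₀) (hπ : 0 < π₀)
    (hπ1 : π₀ ≤ 1) (η : ℝ) : Integrable (F.psiPos η) Q :=
  .of_bound (hF.measurable_psiPos η).aestronglyMeasurable _ (ae_of_all _ fun o =>
    hreg.abs_psiPos_le hπ hπ1 η o)

lemma IsMeasurable.integrable_psiNeg (hF : F.IsMeasurable) (hreg : F.Regular m₀ π₀) (hπ : 0 < π₀)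
    (hπ1 : π₀ ≤ 1) (hγ0 : 0 ≤ γ) (hγ1 : γ ≤ 1) (η : ℝ) : Integrable (F.psiNeg γ η) Q :=
  .of_bound (hF.measurable_psiNeg γ η).aestronglyMeasurable _ (ae_of_all _ fun o =>
    hreg.abs_psiNeg_le hπ hπ1 hγ0 hγ1 η o)

lemma measure_exists_lt_abs_centered_mean_psi_le
    (hF : F.IsMeasurable) (hreg : F.Regular m₀ π₀) (hπ : 0 < π₀) (hπ1 : π₀ ≤ 1) (hγ0 : 0 ≤ γ)
    (hγ1 : γ ≤ 1) {N : ℕ} (hN : 0 < N) {u : ℝ} (hu : 0 < u) :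
    (Measure.pi fun _ : Fin N => Q) {s | ∃ η,
        2 * (π₀⁻¹ * (1 + m₀) * u) < |(1 / (N : ℝ)) * ∑ i, F.psi γ η (s i) - ∫ o, F.psi γ η o ∂Q|}
      ≤ 8 * ENNReal.ofReal (Real.exp (-(N * u ^ 2 / 128))) := by
  set B := π₀⁻¹ * (1 + m₀)
  have : Nonempty (Fin N) := ⟨⟨0, hN⟩⟩
  have hB0 : 0 < B := by have := hreg.nonneg; positivity
  have hN0 : (0 : ℝ) < N := by exact_mod_cast hN
  have hpos := measure_exists_lt_abs_sum_centered_le (ι := Fin N) (Q := Q)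
    hF.measurable_psiPos hreg.monotone_psiPos hB0 (hreg.abs_psiPos_le hπ hπ1) hu
  have hneg := measure_exists_lt_abs_sum_centered_le (ι := Fin N) (Q := Q)
    (hF.measurable_psiNeg γ) (hreg.monotone_psiNeg γ) hB0 (hreg.abs_psiNeg_le hπ hπ1 hγ0 hγ1) hu
  rw [Fintype.card_fin] at hpos hneg
  refine (measure_mono ?_).trans ((measure_union_le _ _).trans
    ((add_le_add hpos hneg).trans_eq (by rw [← add_mul]; norm_num)))
  rintro s ⟨η, hη⟩
  simp only [Set.mem_union, Set.mem_ofPred_eq]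
  by_contra! hs
  have hdiff : (1 / (N : ℝ)) * ∑ i, F.psi γ η (s i) - ∫ o, F.psi γ η o ∂Q
      = (1 / (N : ℝ)) * (∑ i, (F.psiPos η (s i) - ∫ o, F.psiPos η o ∂Q)
        - ∑ i, (F.psiNeg γ η (s i) - ∫ o, F.psiNeg γ η o ∂Q)) := by
    simp only [psi_eq_psiPos_sub_psiNeg]
    rw [integral_sub (hF.integrable_psiPos hreg hπ hπ1 η)
      (hF.integrable_psiNeg hreg hπ hπ1 hγ0 hγ1 η)]
    simp only [Finset.sum_sub_distrib, Finset.sum_const, Finset.card_univ, Fintype.card_fin,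
      nsmul_eq_mul]
    field_simp
    ring
  refine hη.not_ge ?_
  rw [hdiff, abs_mul, abs_of_nonneg (by positivity), one_div, inv_mul_le_iff₀ hN0]
  exact (abs_sub _ _).trans (by linarith [hs.1 η, hs.2 η])

-- The constant `40 = 2 * 20` balances `20 ^ 2 / 128 = 25 / 8` against the `8` of the tail bound.
lemma measure_exists_lt_abs_centered_mean_psi_le_ofReal
    (hF : F.IsMeasurable) (hreg : F.Regular m₀ π₀) (hπ : 0 < π₀) (hπ1 : π₀ ≤ 1) (hγ0 : 0 ≤ γ)
    (hγ1 : γ ≤ 1) {N : ℕ} (hN : 0 < N) {δ : ℝ} (hδ : 0 < δ) :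
    (Measure.pi fun _ : Fin N => Q) {s | ∃ η,
        40 * (π₀⁻¹ * (1 + m₀)) * √((Real.log (1 / δ) + 1) / N)
          < |(1 / (N : ℝ)) * ∑ i, F.psi γ η (s i) - ∫ o, F.psi γ η o ∂Q|} ≤ ENNReal.ofReal δ := by
  rcases le_total 1 δ with h1 | h1
  · exact prob_le_one.trans (ENNReal.one_le_ofReal.mpr h1)
  have hL : 0 ≤ Real.log (1 / δ) := Real.log_nonneg ((one_le_div hδ).mpr h1)
  have : (0 : ℝ) < N := by exact_mod_cast hN
  set r := √((Real.log (1 / δ) + 1) / N)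
  have hr2 : N * (20 * r) ^ 2 / 128 = 25 / 8 * (Real.log (1 / δ) + 1) := by
    rw [mul_pow, Real.sq_sqrt (by positivity)]
    field_simp
    norm_num
  have hdev := measure_exists_lt_abs_centered_mean_psi_le (Q := Q) hF hreg hπ hπ1 hγ0 hγ1 hN
    (u := 20 * r) (by positivity)
  rw [hr2, show (8 : ℝ≥0∞) = ENNReal.ofReal 8 by simp, ← ENNReal.ofReal_mul (by norm_num)] at hdev
  refine (measure_mono fun s => Exists.imp fun η => (Eq.trans_lt ?_)).trans (hdev.trans
    (ENNReal.ofReal_le_ofReal ((eight_mul_exp_neg_le hL).trans_eq ?_)))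
  · ring
  · rw [one_div, Real.log_inv, neg_neg, Real.exp_log hδ]

end Fit

end InfluenceFunction

lemma integral_pos_of_ae_pos {Ω : Type*} [MeasurableSpace Ω] {μ : Measure Ω} [NeZero μ]
    {f : Ω → ℝ} (hf : ∀ᵐ ω ∂μ, 0 < f ω) (hi : Integrable f μ) : 0 < ∫ ω, f ω ∂μ := by
  rw [integral_pos_iff_support_of_nonneg_ae (hf.mono fun _ h => h.le) hi, pos_iff_ne_zero]
  intro h0
  obtain ⟨ω, hpos, hzero⟩ := (hf.and (measure_eq_zero_iff_ae_notMem.mp h0)).exists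
  exact hzero hpos.ne'

lemma integral_mul_condExp_eq {Ω : Type*} {m m₀ : MeasurableSpace Ω} {μ : Measure Ω}
    (hm : m ≤ m₀) [SigmaFinite (μ.trim hm)] {f g : Ω → ℝ} (hg : StronglyMeasurable[m] g)
    (hgf : Integrable (g * f) μ) (hf : Integrable f μ) :
    ∫ ω, g ω * (μ[f | m]) ω ∂μ = ∫ ω, g ω * f ω ∂μ := by
  rw [← integral_condExp hm (f := fun ω => g ω * f ω)]
  exact integral_congr_ae (condExp_mul_of_stronglyMeasurable_left hg hgf hf).symm

section Response

variable {k : ℕ} {Q : Measure (Obs k)}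

/-- Weak overlap for the response: `0 < P(R = 1 | X, D) < 1` almost surely. -/
def ResponsePositivity (Q : Measure (Obs k)) : Prop := ∀ᵐ o ∂Q, 0 < eR Q o ∧ eR Q o < 1

lemma Overlap.responsePositivity (h : Overlap Q) : ResponsePositivity Q := by
  obtain ⟨c, hc, -, h⟩ := h
  filter_upwards [h] with o ho
  exact ⟨hc.trans ho.1, ho.2.trans (sub_lt_self 1 hc)⟩

/-- The σ-algebra generated by `(X, D, Y(1), Y(0))`, that is, by everything except the response. -/
@[reducible] def sigmaXDY (k : ℕ) : MeasurableSpace (Obs k) :=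
  MeasurableSpace.comap (fun o => (XD o, potential o)) inferInstance

lemma sigmaXDY_le : sigmaXDY k ≤ (inferInstance : MeasurableSpace (Obs k)) :=
  (measurable_XD.prodMk measurable_potential).comap_le

lemma sigmaXD_le_sigmaXDY : sigmaXD k ≤ sigmaXDY k := by
  rintro _ ⟨s, hs, rfl⟩
  exact ⟨Prod.fst ⁻¹' s, measurable_fst hs, rfl⟩

lemma measurableSet_response (b : Bool) : MeasurableSet {o : Obs k | R o = b} :=
  measurable_R (measurableSet_singleton b)

lemma compl_response_true : {o : Obs k | R o = true}ᶜ = {o | R o = false} :=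
  Set.ext fun o => iff_of_eq (Bool.not_eq_true (R o))

lemma stronglyMeasurable_eR : StronglyMeasurable[sigmaXD k] (eR Q) := stronglyMeasurable_condExp

lemma measurable_eR : Measurable (eR Q) := (stronglyMeasurable_eR.mono sigmaXD_le).measurable

lemma integrable_eR : Integrable (eR Q) Q := integrable_condExp

lemma measurable_piR : Measurable (piR Q) := measurable_eR.div (measurable_const.sub measurable_eR)

lemma ResponsePositivity.abs_eR_le_one (hO : ResponsePositivity Q) : ∀ᵐ o ∂Q, |eR Q o| ≤ 1 := by
  filter_upwards [hO] with o ho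
  rw [abs_of_pos ho.1]
  exact ho.2.le

lemma ResponsePositivity.integrable_eR_mul (hO : ResponsePositivity Q) {h : Obs k → ℝ}
    (hi : Integrable h Q) : Integrable (fun o => eR Q o * h o) Q :=
  hi.bdd_mul measurable_eR.aestronglyMeasurable hO.abs_eR_le_one

variable [IsProbabilityMeasure Q]

lemma MissingAtRandom.condExp_sigmaXDY_ae_eq (hM : MissingAtRandom Q) :
    Q[{o | R o = true}.indicator (fun _ => (1 : ℝ)) | sigmaXDY k] =ᵐ[Q] eR Q := by
  have hdistrib := (condIndepFun_iff_condDistrib_prod_ae_eq_prodMkRight measurable_R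
    measurable_potential measurable_XD).mp hM
  have hXDY := condDistrib_ae_eq_condExp (μ := Q) (measurable_XD.prodMk measurable_potential)
    measurable_R (measurableSet_singleton true)
  have hXD := condDistrib_ae_eq_condExp (μ := Q) measurable_XD measurable_R
    (measurableSet_singleton true)
  filter_upwards [hXDY, hXD, ae_of_ae_map
    (measurable_XD.prodMk measurable_potential).aemeasurable hdistrib] with o h1 h2 h3
  rw [h3] at h1
  exact h1.symm.trans h2

lemma MissingAtRandom.setIntegral_response_true (hM : MissingAtRandom Q) {h : Obs k → ℝ}
    (hm : StronglyMeasurable[sigmaXDY k] h) (hi : Integrable h Q) :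
    ∫ o in {o | R o = true}, h o ∂Q = ∫ o, eR Q o * h o ∂Q := by
  have hR := measurableSet_response (k := k) true
  have hmul : {o : Obs k | R o = true}.indicator h
      = {o | R o = true}.indicator (fun _ => (1 : ℝ)) * h := by
    ext o
    simp only [Pi.mul_apply, Set.indicator_apply, ite_mul, one_mul, zero_mul]
  have hpull := condExp_mul_of_stronglyMeasurable_right hm (hmul ▸ hi.indicator hR)
    ((integrable_const 1).indicator hR)
  rw [← integral_indicator hR, hmul, ← integral_condExp sigmaXDY_le]
  refine integral_congr_ae ?_
  filter_upwards [hpull, hM.condExp_sigmaXDY_ae_eq] with o h1 h2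
  rw [← h2]
  exact h1

lemma MissingAtRandom.setIntegral_response_false (hM : MissingAtRandom Q)
    (hO : ResponsePositivity Q) {h : Obs k → ℝ} (hm : StronglyMeasurable[sigmaXDY k] h)
    (hi : Integrable h Q) :
    ∫ o in {o | R o = false}, h o ∂Q = ∫ o, (1 - eR Q o) * h o ∂Q := by
  have hsplit := integral_add_compl (measurableSet_response (k := k) true) hi
  rw [compl_response_true, hM.setIntegral_response_true hm hi] at hsplit
  simp only [sub_mul, one_mul]
  rw [integral_sub hi (hO.integrable_eR_mul hi), ← hsplit, add_sub_cancel_left]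

lemma integral_eR : ∫ o, eR Q o ∂Q = Q.real {o | R o = true} := by
  rw [eR, integral_condExp sigmaXD_le, integral_indicator_const _ (measurableSet_response true),
    smul_eq_mul, mul_one]

lemma ResponsePositivity.measure_response_true_ne_zero (hO : ResponsePositivity Q) :
    Q {o | R o = true} ≠ 0 := by
  refine (measureReal_ne_zero_iff).mp ?_
  rw [← integral_eR]
  exact (integral_pos_of_ae_pos (hO.mono fun _ h => h.1) integrable_eR).ne'

lemma ResponsePositivity.probAttrition_pos (hO : ResponsePositivity Q) : 0 < probAttrition Q := by
  have hpos := integral_pos_of_ae_pos (hO.mono fun _ h => sub_pos.mpr h.2)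
    ((integrable_const 1).sub integrable_eR)
  rwa [integral_sub (integrable_const 1) integrable_eR, integral_const, probReal_univ,
    one_smul, integral_eR, ← probReal_compl_eq_one_sub (measurableSet_response true),
    compl_response_true] at hpos

end Response

section Identification

variable {k : ℕ} {Q : Measure (Obs k)} {F : Fit k} {γ m₀ π₀ : ℝ}

lemma stronglyMeasurable_comp_XD {g : Cov k × Bool → ℝ} (hg : Measurable g) :
    StronglyMeasurable[sigmaXD k] fun o : Obs k => g (XD o) :=
  (hg.comp (comap_measurable XD)).stronglyMeasurable

lemma Fit.stronglyMeasurable_mC (F : Fit k) (η : ℝ) : StronglyMeasurable[sigmaXD k] (F.mC Q η) :=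
  stronglyMeasurable_condExp

lemma Fit.IsMeasurable.stronglyMeasurable_belowIndicator (hF : F.IsMeasurable) (η : ℝ) :
    StronglyMeasurable[sigmaXDY k] (F.belowIndicator η) := by
  have hfill : Measurable fun p : (Cov k × Bool) × ℝ × ℝ =>
      ((p.1.1, p.2.1, p.2.2, p.1.2, true) : Obs k) := by fun_prop
  exact (((hF.measurable_belowIndicator η).comp hfill).comp (comap_measurable
    fun o : Obs k => (XD o, potential o))).stronglyMeasurable

namespace Fit

/-- `E[(1 - R) - R / π̂_R | X, D]`, which vanishes when `π̂_R` is the true odds `π_R`. -/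
noncomputable def imbalance (F : Fit k) (Q : Measure (Obs k)) (o : Obs k) : ℝ :=
  (1 - eR Q o) - eR Q o * (F.piHat (X o) (D o))⁻¹

lemma IsMeasurable.stronglyMeasurable_piHat (hF : F.IsMeasurable) :
    StronglyMeasurable[sigmaXD k] fun o : Obs k => F.piHat (X o) (D o) :=
  stronglyMeasurable_comp_XD hF.piHat

lemma IsMeasurable.stronglyMeasurable_imbalance (hF : F.IsMeasurable) :
    StronglyMeasurable[sigmaXD k] (F.imbalance Q) :=
  (stronglyMeasurable_const.sub stronglyMeasurable_eR).sub
    (stronglyMeasurable_eR.mul hF.stronglyMeasurable_piHat.inv₀)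

lemma Regular.abs_imbalance_le (hreg : F.Regular m₀ π₀) (hπ : 0 < π₀)
    (hO : ResponsePositivity Q) :
    ∀ᵐ o ∂Q, |F.imbalance Q o| ≤ π₀⁻¹ * |F.piHat (X o) (D o) - piR Q o| := by
  filter_upwards [hO] with o ⟨h0, h1⟩
  have hπ0 : F.piHat (X o) (D o) ≠ 0 := abs_pos.mp (hπ.trans_le (hreg.lower _ _))
  have he : 1 - eR Q o ≠ 0 := (sub_pos.mpr h1).ne'
  have hfactor : F.imbalance Q o
      = (1 - eR Q o) * (F.piHat (X o) (D o))⁻¹ * (F.piHat (X o) (D o) - piR Q o) := by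
    rw [imbalance, piR]
    field_simp
  rw [hfactor, abs_mul, abs_mul, abs_of_pos (sub_pos.mpr h1)]
  gcongr
  exact (mul_le_of_le_one_left (abs_nonneg _) (sub_le_self 1 h0.le)).trans
    (hreg.abs_inv_piHat_le hπ o)

lemma IsMeasurable.integrable_inv_piHat_mul (hF : F.IsMeasurable) (hreg : F.Regular m₀ π₀)
    (hπ : 0 < π₀) {h : Obs k → ℝ} (hi : Integrable h Q) :
    Integrable (fun o => (F.piHat (X o) (D o))⁻¹ * h o) Q :=
  hi.bdd_mul hF.measurable_piHat.inv.aestronglyMeasurable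
    (ae_of_all _ (hreg.abs_inv_piHat_le hπ))

lemma IsMeasurable.integrable_imbalance_mul (hF : F.IsMeasurable) (hreg : F.Regular m₀ π₀)
    (hπ : 0 < π₀) (hO : ResponsePositivity Q) {h : Obs k → ℝ} (hi : Integrable h Q) :
    Integrable (F.imbalance Q * h) Q := by
  have he := hO.integrable_eR_mul hi
  refine ((hi.sub he).sub (hF.integrable_inv_piHat_mul hreg hπ he)).congr
    (ae_of_all _ fun o => ?_)
  simp only [Pi.sub_apply, Pi.mul_apply, imbalance]
  ring

lemma eLpNorm_le_mError (F : Fit k) (Q : Measure (Obs k)) (η : ℝ) :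
    eLpNorm (fun o => F.mHat η (X o) (D o) - F.mC Q η o) 2 Q ≤ F.mError Q :=
  le_iSup (fun η : ℝ => eLpNorm (fun o => F.mHat η (X o) (D o) - F.mC Q η o) 2 Q) η

lemma ofReal_abs_integral_imbalance_mul_le (hF : F.IsMeasurable) (hreg : F.Regular m₀ π₀)
    (hπ : 0 < π₀) (hO : ResponsePositivity Q) (η : ℝ) :
    ENNReal.ofReal |∫ o, F.imbalance Q o * (F.mHat η (X o) (D o) - F.mC Q η o) ∂Q|
      ≤ ENNReal.ofReal π₀⁻¹ * (F.piError Q * F.mError Q) := by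
  set a : Obs k → ℝ := fun o => F.mHat η (X o) (D o) - F.mC Q η o
  set b : Obs k → ℝ := fun o => F.piHat (X o) (D o) - piR Q o
  have ha : AEStronglyMeasurable a Q :=
    ((hF.measurable_mHat η).sub
      ((F.stronglyMeasurable_mC η).mono sigmaXD_le).measurable).aestronglyMeasurable
  have hb : AEStronglyMeasurable b Q :=
    (hF.measurable_piHat.sub measurable_piR).aestronglyMeasurable
  rw [← Real.enorm_eq_ofReal_abs]
  calc ‖∫ o, F.imbalance Q o * a o ∂Q‖ₑ
      ≤ ∫⁻ o, ‖F.imbalance Q o * a o‖ₑ ∂Q := enorm_integral_le_lintegral_enorm _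
    _ ≤ ∫⁻ o, ENNReal.ofReal π₀⁻¹ * ‖(b • a) o‖ₑ ∂Q := by
        refine lintegral_mono_ae ((hreg.abs_imbalance_le hπ hO).mono fun o ho => ?_)
        rw [Pi.smul_apply', smul_eq_mul, enorm_mul, enorm_mul, ← mul_assoc]
        refine mul_le_mul_left ?_ _
        rw [Real.enorm_eq_ofReal_abs, Real.enorm_eq_ofReal_abs,
          ← ENNReal.ofReal_mul (inv_nonneg.mpr hπ.le)]
        exact ENNReal.ofReal_le_ofReal ho
    _ = ENNReal.ofReal π₀⁻¹ * eLpNorm (b • a) 1 Q := by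
        rw [lintegral_const_mul' _ _ ENNReal.ofReal_ne_top, eLpNorm_one_eq_lintegral_enorm]
    _ ≤ ENNReal.ofReal π₀⁻¹ * (F.piError Q * F.mError Q) := by
        gcongr
        exact (eLpNorm_smul_le_mul_eLpNorm ha hb).trans
          (mul_le_mul_right (F.eLpNorm_le_mError Q η) _)

end Fit

lemma setIntegral_responding {s : Set (Obs k)} (hs : MeasurableSet s) (f : Obs k → ℝ) :
    ∫ o in s, f o ∂(responding Q)
      = (Q {o | R o = true})⁻¹.toReal * ∫ o in {o | R o = true}, s.indicator f o ∂Q := by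
  rw [responding, ProbabilityTheory.cond, Measure.restrict_smul, integral_smul_measure,
    smul_eq_mul, integral_indicator hs]

variable [IsProbabilityMeasure Q]

lemma measure_eq_zero_of_response_true (hO : ResponsePositivity Q) {s : Set (Obs k)}
    (hs : MeasurableSet[sigmaXD k] s) (h0 : Q (s ∩ {o | R o = true}) = 0) : Q s = 0 := by
  by_contra hne
  have : NeZero (Q.restrict s) := ⟨mt Measure.restrict_eq_zero.mp hne⟩
  refine (integral_pos_of_ae_pos (μ := Q.restrict s) ((ae_restrict_of_ae hO).mono fun _ h => h.1)
    integrable_eR.integrableOn).ne' ?_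
  rw [eR, setIntegral_condExp sigmaXD_le ((integrable_const 1).indicator
    (measurableSet_response true)) hs, setIntegral_indicator (measurableSet_response true),
    Measure.restrict_eq_zero.mpr h0, integral_zero_measure]

lemma integrable_responding (hO : ResponsePositivity Q) {f : Obs k → ℝ} (hf : Integrable f Q) :
    Integrable f (responding Q) :=
  hf.integrableOn.smul_measure (ENNReal.inv_ne_top.mpr hO.measure_response_true_ne_zero)

namespace Fit

lemma IsMeasurable.integrable_belowIndicator (hF : F.IsMeasurable) (η : ℝ) :
    Integrable (F.belowIndicator η) Q :=
  (integrable_const 1).indicator (hF.measurableSet_score_lt η)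

/- Pulling out `1{s}` and using missingness at random, both sides of the defining identity of
`m_C` become integrals against `e_R(X, D) 1{s}`. -/
lemma IsMeasurable.mC_ae_eq_condExp (hF : F.IsMeasurable) (hM : MissingAtRandom Q)
    (hO : ResponsePositivity Q) (η : ℝ) :
    F.mC Q η =ᵐ[Q] Q[F.belowIndicator η | sigmaXD k] := by
  set p := Q[F.belowIndicator η | sigmaXD k]
  have hp : StronglyMeasurable[sigmaXD k] p := stronglyMeasurable_condExp
  have hV := hF.integrable_belowIndicator (Q := Q) η
  have hset (s : Set (Obs k)) (hs : MeasurableSet[sigmaXD k] s) :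
      ∫ o in s, p o ∂(responding Q) = ∫ o in s, F.belowIndicator η o ∂(responding Q) := by
    have hs' := sigmaXD_le s hs
    rw [setIntegral_responding hs', setIntegral_responding hs',
      hM.setIntegral_response_true ((hp.indicator hs).mono sigmaXD_le_sigmaXDY)
        (integrable_condExp.indicator hs'),
      hM.setIntegral_response_true ((hF.stronglyMeasurable_belowIndicator η).indicator
        (sigmaXD_le_sigmaXDY s hs)) (hV.indicator hs')]
    have hmul (f : Obs k → ℝ) :
        (fun o => eR Q o * s.indicator f o) = s.indicator (eR Q) * f :=
      funext fun _ => (Set.indicator_mul_right ..).symm.trans (Set.indicator_mul_left ..)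
    rw [hmul, hmul]
    congr 1
    exact integral_mul_condExp_eq sigmaXD_le (stronglyMeasurable_eR.indicator hs)
      (hmul _ ▸ hO.integrable_eR_mul (hV.indicator hs')) hV
  have : IsProbabilityMeasure (responding Q) :=
    cond_isProbabilityMeasure hO.measure_response_true_ne_zero
  have hresp : p =ᵐ[responding Q] F.mC Q η :=
    ae_eq_condExp_of_forall_setIntegral_eq sigmaXD_le (integrable_responding hO hV)
      (fun s _ _ => (integrable_responding hO integrable_condExp).integrableOn)
      (fun s hs _ => hset s hs) hp.aestronglyMeasurable
  have hne : MeasurableSet[sigmaXD k] {o | F.mC Q η o = p o}ᶜ :=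
    (measurableSet_eq_fun (F.stronglyMeasurable_mC η).measurable hp.measurable).compl
  refine measure_eq_zero_of_response_true hO hne ?_
  have hcond : responding Q {o | F.mC Q η o = p o}ᶜ = 0 := hresp.symm
  rw [responding, cond_apply (measurableSet_response true), Set.inter_comm] at hcond
  exact (mul_eq_zero.mp hcond).resolve_left (ENNReal.inv_ne_zero.mpr (measure_ne_top _ _))

lemma IsMeasurable.integrable_mHat (hF : F.IsMeasurable) (hreg : F.Regular m₀ π₀) (η : ℝ) :
    Integrable (fun o => F.mHat η (X o) (D o)) Q :=
  .of_bound (hF.measurable_mHat η).aestronglyMeasurable _ (ae_of_all _ fun _ => hreg.bound _ _ _)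

lemma IsMeasurable.integrable_psi (hF : F.IsMeasurable) (hreg : F.Regular m₀ π₀) (hπ : 0 < π₀)
    (γ η : ℝ) : Integrable (F.psi γ η) Q := by
  have hm := hF.integrable_mHat (Q := Q) hreg η
  have hfalse : Integrable (fun o => if R o then 0 else F.mHat η (X o) (D o) - (1 - γ)) Q := by
    refine ((hm.sub (integrable_const (1 - γ))).indicator (measurableSet_response false)).congr
      (ae_of_all _ fun o => ?_)
    cases hR : R o <;> simp [hR]
  have htrue := ((hF.integrable_belowIndicator (Q := Q) η).sub hm).bdd_mul
    hF.measurable_weight.aestronglyMeasurable (ae_of_all _ (hreg.abs_weight_le hπ))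
  exact (hfalse.add htrue).congr (ae_of_all _ fun o => (F.psi_eq γ η o).symm)

lemma integral_imbalance_mul_belowIndicator (hF : F.IsMeasurable) (hreg : F.Regular m₀ π₀)
    (hπ : 0 < π₀) (hM : MissingAtRandom Q) (hO : ResponsePositivity Q) (η : ℝ) :
    ∫ o, F.imbalance Q o * F.belowIndicator η o ∂Q = ∫ o, F.imbalance Q o * F.mC Q η o ∂Q := by
  have hV := hF.integrable_belowIndicator (Q := Q) η
  rw [← integral_mul_condExp_eq sigmaXD_le hF.stronglyMeasurable_imbalance
    (hF.integrable_imbalance_mul hreg hπ hO hV) hV]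
  exact integral_congr_ae ((hF.mC_ae_eq_condExp hM hO η).symm.mono fun o ho =>
    congrArg (F.imbalance Q o * ·) ho)

lemma integral_imbalance_mul_sub (hF : F.IsMeasurable) (hreg : F.Regular m₀ π₀)
    (hπ : 0 < π₀) (hM : MissingAtRandom Q) (hO : ResponsePositivity Q) (η : ℝ) :
    ∫ o, F.imbalance Q o * (F.mHat η (X o) (D o) - F.belowIndicator η o) ∂Q
      = ∫ o, F.imbalance Q o * (F.mHat η (X o) (D o) - F.mC Q η o) ∂Q := by
  have hm := hF.integrable_imbalance_mul hreg hπ hO (hF.integrable_mHat (Q := Q) hreg η)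
  have hV := hF.integrable_imbalance_mul hreg hπ hO (hF.integrable_belowIndicator (Q := Q) η)
  have hC := hF.integrable_imbalance_mul hreg hπ hO
    (integrable_condExp.congr (hF.mC_ae_eq_condExp hM hO η).symm)
  simp only [mul_sub]
  exact (integral_sub hm hV).trans <| (congrArg _ <|
    integral_imbalance_mul_belowIndicator hF hreg hπ hM hO η).trans (integral_sub hm hC).symm

lemma setIntegral_response_true_psi (hF : F.IsMeasurable) (hreg : F.Regular m₀ π₀) (hπ : 0 < π₀)
    (hM : MissingAtRandom Q) (γ η : ℝ) :
    ∫ o in {o | R o = true}, F.psi γ η o ∂Q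
      = -∫ o, eR Q o * ((F.piHat (X o) (D o))⁻¹
          * (F.mHat η (X o) (D o) - F.belowIndicator η o)) ∂Q := by
  have hi := hF.integrable_inv_piHat_mul hreg hπ
    ((hF.integrable_mHat (Q := Q) hreg η).sub (hF.integrable_belowIndicator η))
  have hs := (hF.stronglyMeasurable_piHat.inv₀.mono sigmaXD_le_sigmaXDY).mul
    (((stronglyMeasurable_comp_XD (hF.mHat η)).mono sigmaXD_le_sigmaXDY).sub
      (hF.stronglyMeasurable_belowIndicator η))
  refine Eq.trans ?_ (congrArg Neg.neg (hM.setIntegral_response_true hs hi))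
  rw [← integral_neg]
  refine setIntegral_congr_fun (measurableSet_response true) fun o ho => ?_
  rw [Set.mem_ofPred_eq] at ho
  simp only [psi_eq, weight, ho, if_true, zero_add]
  ring

lemma setIntegral_response_false_psi (hF : F.IsMeasurable) (hreg : F.Regular m₀ π₀)
    (hM : MissingAtRandom Q) (hO : ResponsePositivity Q) (γ η : ℝ) :
    ∫ o in {o | R o = false}, F.psi γ η o ∂Q
      = ∫ o in {o | R o = false}, (F.belowIndicator η o - (1 - γ)) ∂Q
        + ∫ o, (1 - eR Q o) * (F.mHat η (X o) (D o) - F.belowIndicator η o) ∂Q := by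
  have hV := hF.integrable_belowIndicator (Q := Q) η
  have hd := (hF.integrable_mHat (Q := Q) hreg η).sub hV
  have hc := hV.sub (integrable_const (1 - γ))
  have hs := ((stronglyMeasurable_comp_XD (hF.mHat η)).mono sigmaXD_le_sigmaXDY).sub
    (hF.stronglyMeasurable_belowIndicator η)
  refine Eq.trans ?_ ((integral_add hc.integrableOn hd.integrableOn).trans
    (congrArg _ (hM.setIntegral_response_false hO hs hd)))
  refine setIntegral_congr_fun (measurableSet_response false) fun o ho => ?_
  rw [Set.mem_ofPred_eq] at ho
  simp only [psi_eq, weight, ho, Bool.false_eq_true, if_false, Pi.sub_apply]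
  ring

lemma integral_psi (hF : F.IsMeasurable) (hreg : F.Regular m₀ π₀) (hπ : 0 < π₀)
    (hM : MissingAtRandom Q) (hO : ResponsePositivity Q) (γ η : ℝ) :
    ∫ o, F.psi γ η o ∂Q = ∫ o in {o | R o = false}, (F.belowIndicator η o - (1 - γ)) ∂Q
      + ∫ o, F.imbalance Q o * (F.mHat η (X o) (D o) - F.mC Q η o) ∂Q := by
  set d : Obs k → ℝ := fun o => F.mHat η (X o) (D o) - F.belowIndicator η o
  have hd : Integrable d Q := (hF.integrable_mHat hreg η).sub (hF.integrable_belowIndicator η)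
  have hed : Integrable (fun o => (1 - eR Q o) * d o) Q := by
    simp only [sub_mul, one_mul]
    exact hd.sub (hO.integrable_eR_mul hd)
  have hsplit : ∫ o, F.imbalance Q o * d o ∂Q
      = ∫ o, (1 - eR Q o) * d o ∂Q - ∫ o, eR Q o * ((F.piHat (X o) (D o))⁻¹ * d o) ∂Q := by
    rw [← integral_sub hed (hO.integrable_eR_mul (hF.integrable_inv_piHat_mul hreg hπ hd))]
    simp only [imbalance, sub_mul _ _ (d _), mul_assoc]
  rw [← integral_imbalance_mul_sub hF hreg hπ hM hO, hsplit,
    ← integral_add_compl (measurableSet_response true) (hF.integrable_psi hreg hπ γ η),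
    compl_response_true, setIntegral_response_true_psi hF hreg hπ hM,
    setIntegral_response_false_psi hF hreg hM hO]
  ring

lemma coverage_coe_eq_ofReal (hp : 0 < probAttrition Q) (η : ℝ) :
    F.coverage Q η = ENNReal.ofReal
      (Q.real ({o | F.score o < η} ∩ {o | R o = false}) / probAttrition Q) := by
  rw [ENNReal.ofReal_div_of_pos hp, probAttrition, ofReal_measureReal, ofReal_measureReal,
    coverage, attrited, cond_apply (measurableSet_response false), Set.inter_comm,
    ENNReal.div_eq_inv_mul]
  simp only [EReal.coe_lt_coe_iff]

lemma setIntegral_response_false_belowIndicator_sub (hF : F.IsMeasurable) (γ η : ℝ) :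
    ∫ o in {o | R o = false}, (F.belowIndicator η o - (1 - γ)) ∂Q
      = Q.real ({o | F.score o < η} ∩ {o | R o = false}) - probAttrition Q * (1 - γ) := by
  rw [integral_sub (hF.integrable_belowIndicator η).integrableOn (integrable_const _),
    belowIndicator, integral_indicator_const _ (hF.measurableSet_score_lt η),
    measureReal_restrict_apply (hF.measurableSet_score_lt η), setIntegral_const, smul_eq_mul,
    mul_one, smul_eq_mul, probAttrition]

lemma le_coverage_of_neg_le_integral_psi (hF : F.IsMeasurable) (hreg : F.Regular m₀ π₀)
    (hπ : 0 < π₀) (hM : MissingAtRandom Q) (hO : ResponsePositivity Q) {η u : ℝ}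
    (hu : -u ≤ ∫ o, F.psi γ η o ∂Q) :
    ENNReal.ofReal (1 - γ) ≤ F.coverage Q η + ENNReal.ofReal (u / probAttrition Q)
      + F.productError Q 1 π₀ := by
  have hp := hO.probAttrition_pos
  rw [integral_psi hF hreg hπ hM hO, setIntegral_response_false_belowIndicator_sub hF] at hu
  have hbias := ofReal_abs_integral_imbalance_mul_le hF hreg hπ hO η
  set bias := ∫ o, F.imbalance Q o * (F.mHat η (X o) (D o) - F.mC Q η o) ∂Q
  have hle : 1 - γ ≤ Q.real ({o | F.score o < η} ∩ {o | R o = false}) / probAttrition Q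
      + u / probAttrition Q + |bias| / probAttrition Q := by
    rw [← add_div, ← add_div, le_div_iff₀ hp]
    linarith only [le_abs_self bias, hu]
  calc ENNReal.ofReal (1 - γ)
      ≤ F.coverage Q η + ENNReal.ofReal (u / probAttrition Q)
          + ENNReal.ofReal (|bias| / probAttrition Q) := by
        rw [coverage_coe_eq_ofReal hp]
        exact (ENNReal.ofReal_le_ofReal hle).trans
          (ENNReal.ofReal_add_le.trans (add_le_add_left ENNReal.ofReal_add_le _))
    _ ≤ F.coverage Q η + ENNReal.ofReal (u / probAttrition Q) + F.productError Q 1 π₀ := by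
        rw [productError, one_mul, ENNReal.ofReal_div_of_pos hp, ENNReal.ofReal_div_of_pos hp,
          ENNReal.ofReal_div_of_pos hp, ENNReal.mul_div_right_comm.symm]
        gcongr

end Fit

end Identification

section Threshold

lemma le_measure_le_sInf {Ω : Type*} [MeasurableSpace Ω] {μ : Measure Ω} [IsFiniteMeasure μ]
    {f : Ω → EReal} (hf : Measurable f) {S : Set EReal} {c : ℝ≥0∞} (hc : c ≤ μ Set.univ)
    (hS : ∀ b ∈ S, c ≤ μ {ω | f ω < b}) : c ≤ μ {ω | f ω ≤ sInf S} := by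
  rcases (le_top (a := sInf S)).eq_or_lt with htop | hlt
  · simpa only [htop, le_top, Set.ofPred_true] using hc
  obtain ⟨b, hb, hbS, hlim⟩ := exists_seq_strictAnti_tendsto' hlt
  have hset : {ω | f ω ≤ sInf S} = ⋂ n, {ω | f ω < b n} := by
    ext ω
    simp only [Set.mem_iInter, Set.mem_ofPred_eq]
    exact ⟨fun h n => h.trans_lt (hbS n).1, fun h => ge_of_tendsto' hlim fun n => (h n).le⟩
  rw [hset]
  refine ge_of_tendsto' (tendsto_measure_iInter_atTop
    (fun n => (measurableSet_lt hf measurable_const).nullMeasurableSet)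
    (fun n m h ω hω => lt_of_lt_of_le hω (hb.antitone h)) ⟨0, measure_ne_top _ _⟩) fun n => ?_
  obtain ⟨a, haS, ha⟩ := sInf_lt_iff.mp (hbS n).1
  exact (hS a haS).trans (measure_mono fun ω hω => lt_trans hω ha)

variable {k : ℕ} {F : Fit k} {Q : Measure (Obs k)} {γ : ℝ} {N : ℕ} {s : Fin N → Obs k}

namespace Fit

/-- `P(V_C ≤ η | R = 0)`, the limit of the coverage at thresholds decreasing to `η`. -/
noncomputable def closedCoverage (F : Fit k) (Q : Measure (Obs k)) (η : EReal) : ℝ≥0∞ :=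
  attrited Q {o | (F.score o : EReal) ≤ η}

/-- The least coverage among all solutions of the sample moment condition, and `1` if there are
none. Unlike the coverage at `η̂`, it can be bounded from below solution by solution. -/
noncomputable def infCoverage (F : Fit k) (Q : Measure (Obs k)) (γ : ℝ) (s : Fin N → Obs k) :
    ℝ≥0∞ :=
  1 ⊓ ⨅ η ∈ F.solutions γ s, F.coverage Q (η : ℝ)

lemma infCoverage_le_coverage {η : ℝ} (hη : η ∈ F.solutions γ s) :
    F.infCoverage Q γ s ≤ F.coverage Q η :=
  inf_le_right.trans (iInf₂_le η hη)

lemma infCoverage_le_closedCoverage_etaHat [IsProbabilityMeasure (attrited Q)]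
    (hF : F.IsMeasurable) : F.infCoverage Q γ s ≤ F.closedCoverage Q (F.etaHat γ s) :=
  le_measure_le_sInf hF.score.coe_real_ereal (inf_le_left.trans measure_univ.ge)
    (Set.forall_mem_image.mpr fun _ => infCoverage_le_coverage)

lemma Attained.infCoverage_le_coverage_etaHat (h : F.Attained γ s) :
    F.infCoverage Q γ s ≤ F.coverage Q (F.etaHat γ s) := by
  obtain ⟨η, hη⟩ := h
  have heq : F.etaHat γ s = η := (EReal.coe_strictMono.monotone.map_isLeast hη).csInf_eq
  exact heq ▸ infCoverage_le_coverage hη.1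

lemma Atomless.closedCoverage_le_coverage (hA : F.Atomless Q) (η : EReal) :
    F.closedCoverage Q η ≤ F.coverage Q η := by
  have hatom : attrited Q {o | (F.score o : EReal) = η} = 0 := by
    induction η with
    | bot => simp only [EReal.coe_ne_bot, Set.ofPred_false, measure_empty]
    | coe v => simpa only [EReal.coe_eq_coe_iff] using hA v
    | top => simp only [EReal.coe_ne_top, Set.ofPred_false, measure_empty]
  calc F.closedCoverage Q η
      ≤ attrited Q ({o | (F.score o : EReal) < η} ∪ {o | (F.score o : EReal) = η}) :=
        measure_mono fun _ h => h.out.lt_or_eq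
    _ ≤ F.coverage Q η + 0 := hatom ▸ measure_union_le _ _
    _ = F.coverage Q η := add_zero _

lemma closedCoverage_le_containment (F : Fit k) (Q : Measure (Obs k)) (η : EReal) :
    F.closedCoverage Q η ≤ F.containment Q η := by
  refine measure_mono fun o h y hy => ?_
  have hleft : F.hL (X o) - y ≤ F.score o := (sub_le_sub_left hy.1 _).trans (le_max_left _ _)
  have hright : y - F.hR (X o) ≤ F.score o := (sub_le_sub_right hy.2 _).trans (le_max_right _ _)
  exact ⟨(EReal.coe_le_coe_iff.mpr hleft).trans h, (EReal.coe_le_coe_iff.mpr hright).trans h⟩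

lemma containment_le_iteCoverage_add_surrogateMiss (F : Fit k) (Q : Measure (Obs k))
    (η : EReal) : F.containment Q η ≤ F.iteCoverage Q η + F.surrogateMiss Q := by
  refine (measure_mono fun o h => ?_).trans (measure_union_le _ _)
  exact (em (effect o ∈ F.surrogate o)).imp_left (h ·)

lemma neg_le_integral_psi_of_mem_solutions {η u : ℝ}
    (hdev : |(1 / (N : ℝ)) * ∑ i, F.psi γ η (s i) - ∫ o, F.psi γ η o ∂Q| ≤ u)
    (hη : η ∈ F.solutions γ s) : -u ≤ ∫ o, F.psi γ η o ∂Q := by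
  have hmean : 0 ≤ (1 / (N : ℝ)) * ∑ i, F.psi γ η (s i) := hη
  linarith only [hmean, (abs_le.mp hdev).2]

end Fit

lemma ResponsePositivity.isProbabilityMeasure_attrited [IsProbabilityMeasure Q]
    (hO : ResponsePositivity Q) : IsProbabilityMeasure (attrited Q) :=
  cond_isProbabilityMeasure ((measureReal_ne_zero_iff).mp hO.probAttrition_pos.ne')

end Threshold

section Sections

variable {α β : Type*} [MeasurableSpace α] [MeasurableSpace β] {μ : Measure α} {ν : Measure β}
  [IsProbabilityMeasure μ] [SFinite ν] {δ : ℝ≥0∞}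

lemma prod_le_of_ae_measure_prodMk_le {s : Set (α × β)} (hs : MeasurableSet s)
    (h : ∀ᵐ a ∂μ, ν (Prod.mk a ⁻¹' s) ≤ δ) : μ.prod ν s ≤ δ := by
  rw [Measure.prod_apply hs]
  exact (lintegral_mono_ae h).trans_eq (by rw [lintegral_const, measure_univ, mul_one])

/- `T` may fail to be measurable, so the event is enclosed in the union of `{g < r}` over those
rational `r` for which the section `{g(a, ·) < r}` has measure at most `δ`, a measurable condition
on `a` that holds for every `r ≤ T a`. -/
lemma prod_setOf_lt_comp_fst_le {g : α × β → ℝ≥0∞} (hg : Measurable g) {T : α → ℝ≥0∞}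
    (h : ∀ᵐ a ∂μ, ν {b | g (a, b) < T a} ≤ δ) : μ.prod ν {p | g p < T p.1} ≤ δ := by
  set r : ℚ → ℝ≥0∞ := fun q => Real.toNNReal q
  set A : ℚ → Set α := fun q => {a | ν {b | g (a, b) < r q} ≤ δ}
  have hr : Monotone r := fun q q' h =>
    ENNReal.coe_le_coe.mpr (Real.toNNReal_le_toNNReal (Rat.cast_le.mpr h))
  have hlevel (q : ℚ) : MeasurableSet {p | g p < r q} := measurableSet_lt hg measurable_const
  have hmeas : MeasurableSet (⋃ q, {p | p.1 ∈ A q ∧ g p < r q}) :=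
    .iUnion fun q => (measurable_fst (measurable_measure_prodMk_left (hlevel q)
      measurableSet_Iic)).inter (hlevel q)
  have hdir (a : α) : Directed (· ⊆ ·) fun q => {b | a ∈ A q ∧ g (a, b) < r q} := by
    intro q q'
    by_cases hq : a ∈ A q
    · by_cases hq' : a ∈ A q'
      · have hmax : a ∈ A (max q q') := max_rec' (a ∈ A ·) hq hq'
        exact ⟨max q q', fun b hb => ⟨hmax, hb.2.trans_le (hr (le_max_left q q'))⟩,
          fun b hb => ⟨hmax, hb.2.trans_le (hr (le_max_right q q'))⟩⟩
      · exact ⟨q, subset_rfl, fun b hb => absurd hb.1 hq'⟩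
    · exact ⟨q', fun b hb => absurd hb.1 hq, subset_rfl⟩
  have hsection (a : α) : ν (Prod.mk a ⁻¹' ⋃ q, {p | p.1 ∈ A q ∧ g p < r q}) ≤ δ := by
    rw [Set.preimage_iUnion]
    refine ((hdir a).measure_iUnion).trans_le (iSup_le fun q => ?_)
    by_cases hq : a ∈ A q
    · exact (measure_mono fun b hb => hb.2).trans hq
    · simp only [hq, false_and, Set.ofPred_false, measure_empty, zero_le]
  refine le_trans (measure_mono_ae ?_)
    (prod_le_of_ae_measure_prodMk_le hmeas (ae_of_all _ hsection))
  filter_upwards [Measure.quasiMeasurePreserving_fst.ae h] with p hp hlt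
  obtain ⟨q, -, hgq, hqT⟩ := ENNReal.lt_iff_exists_rat_btwn.mp hlt
  exact Set.mem_iUnion.mpr ⟨q, (measure_mono fun b hb => lt_trans hb hqT).trans hp, hgq⟩

end Sections

section FiniteSample

variable {k : ℕ} {Q : Measure (Obs k)} {𝒯 : Type*} [MeasurableSpace 𝒯] {τ : Measure 𝒯}
  {L : 𝒯 → Fit k} {N : ℕ} {γ m₀ π₀ δ : ℝ}

lemma MeasurableFit.measurable_coverage_comp [SFinite (attrited Q)] (hL : MeasurableFit L)
    {e : 𝒯 × (Fin N → Obs k) → EReal} (he : Measurable e) :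
    Measurable fun p => (L p.1).coverage Q (e p) :=
  measurable_measure_prodMk_left (s := {q : (𝒯 × (Fin N → Obs k)) × Obs k |
    ((L q.1.1).score q.2 : EReal) < e q.1}) <| measurableSet_lt
      (hL.measurable_score.comp ((measurable_fst.comp measurable_fst).prodMk
        measurable_snd)).coe_real_ereal (he.comp measurable_fst)

lemma MeasurableFit.measurable_closedCoverage_comp [SFinite (attrited Q)] (hL : MeasurableFit L)
    {e : 𝒯 × (Fin N → Obs k) → EReal} (he : Measurable e) :
    Measurable fun p => (L p.1).closedCoverage Q (e p) :=
  measurable_measure_prodMk_left (s := {q : (𝒯 × (Fin N → Obs k)) × Obs k |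
    ((L q.1.1).score q.2 : EReal) ≤ e q.1}) <| measurableSet_le
      (hL.measurable_score.comp ((measurable_fst.comp measurable_fst).prodMk
        measurable_snd)).coe_real_ereal (he.comp measurable_fst)

variable [IsProbabilityMeasure Q]

lemma Fit.measure_infCoverage_lt_le_ofReal {F : Fit k} (hF : F.IsMeasurable)
    (hreg : F.Regular m₀ π₀) (hπ : 0 < π₀) (hπ1 : π₀ ≤ 1) (hM : MissingAtRandom Q)
    (hO : ResponsePositivity Q) (hγ0 : 0 ≤ γ) (hγ1 : γ ≤ 1) (hN : 0 < N) (hδ : 0 < δ) :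
    (Measure.pi fun _ : Fin N => Q) {s | F.infCoverage Q γ s < ENNReal.ofReal (1 - γ)
      - (ENNReal.ofReal (samplingError Q 40 m₀ π₀ δ N) + F.productError Q 1 π₀)}
      ≤ ENNReal.ofReal δ := by
  refine le_trans (measure_mono fun s hs => ?_)
    (F.measure_exists_lt_abs_centered_mean_psi_le_ofReal (Q := Q) hF hreg hπ hπ1 hγ0 hγ1 hN hδ)
  by_contra hdev
  simp only [Set.mem_ofPred_eq, not_exists, not_lt] at hdev
  refine (Set.mem_ofPred_eq ▸ hs).not_ge (le_inf ?_ (le_iInf₂ fun η hη => ?_))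
  · exact tsub_le_self.trans (ENNReal.ofReal_le_one.mpr (sub_le_self 1 hγ0))
  · have hcov := le_coverage_of_neg_le_integral_psi (γ := γ) hF hreg hπ hM hO
      (neg_le_integral_psi_of_mem_solutions (hdev η) hη)
    rw [tsub_le_iff_right, ← add_assoc]
    refine hcov.trans_eq ?_
    rw [samplingError]
    ring_nf

variable [IsProbabilityMeasure τ]

lemma dataLaw_not_le_le_ofReal (hL : MeasurableFit L) (hreg : ∀ t, (L t).Regular m₀ π₀)
    (hπ : 0 < π₀) (hπ1 : π₀ ≤ 1) (hM : MissingAtRandom Q) (hO : ResponsePositivity Q)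
    (hγ0 : 0 ≤ γ) (hγ1 : γ ≤ 1) (hN : 0 < N) (hδ : 0 < δ)
    {g : 𝒯 × (Fin N → Obs k) → ℝ≥0∞} (hg : Measurable g)
    (hinf : ∀ᵐ t ∂τ, ∀ᵐ s ∂(Measure.pi fun _ : Fin N => Q),
      (L t).infCoverage Q γ s ≤ g (t, s)) :
    dataLaw τ Q N {p | ¬ (ENNReal.ofReal (1 - γ) ≤
        g p + ENNReal.ofReal (samplingError Q 40 m₀ π₀ δ N) + (L p.1).productError Q 1 π₀)}
      ≤ ENNReal.ofReal δ := by
  simp only [add_assoc, not_le, ← lt_tsub_iff_right]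
  refine prod_setOf_lt_comp_fst_le hg (T := fun t => ENNReal.ofReal (1 - γ)
    - (ENNReal.ofReal (samplingError Q 40 m₀ π₀ δ N) + (L t).productError Q 1 π₀))
    (hinf.mono fun t ht => ?_)
  exact (measure_mono_ae (ht.mono fun s hs hlt => hs.trans_lt hlt)).trans
    (Fit.measure_infCoverage_lt_le_ofReal (hL.isMeasurable t) (hreg t) hπ hπ1 hM hO hγ0 hγ1 hN hδ)

lemma dataLaw_not_le_coverage_le_ofReal (hL : MeasurableFit L) (hreg : ∀ t, (L t).Regular m₀ π₀)
    (hπ : 0 < π₀) (hπ1 : π₀ ≤ 1) (hM : MissingAtRandom Q) (hO : ResponsePositivity Q)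
    (hγ0 : 0 ≤ γ) (hγ1 : γ ≤ 1) (hN : 0 < N) (hδ : 0 < δ)
    (hη : Measurable fun p : 𝒯 × (Fin N → Obs k) => (L p.1).etaHat γ p.2)
    (h : (∀ᵐ p ∂(dataLaw τ Q N), (L p.1).Attained γ p.2) ∨ ∀ᵐ t ∂τ, (L t).Atomless Q) :
    dataLaw τ Q N {p | ¬ (ENNReal.ofReal (1 - γ) ≤
        (L p.1).coverage Q ((L p.1).etaHat γ p.2)
          + ENNReal.ofReal (samplingError Q 40 m₀ π₀ δ N) + (L p.1).productError Q 1 π₀)}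
      ≤ ENNReal.ofReal δ := by
  have := hO.isProbabilityMeasure_attrited
  refine dataLaw_not_le_le_ofReal hL hreg hπ hπ1 hM hO hγ0 hγ1 hN hδ
    (hL.measurable_coverage_comp hη) ?_
  rcases h with hatt | hatom
  · filter_upwards [Measure.ae_ae_of_ae_prod hatt] with t ht
    exact ht.mono fun s hs => hs.infCoverage_le_coverage_etaHat
  · filter_upwards [hatom] with t ht
    exact ae_of_all _ fun s => (Fit.infCoverage_le_closedCoverage_etaHat
      (hL.isMeasurable t)).trans (ht.closedCoverage_le_coverage _)

lemma dataLaw_not_le_containment_le_ofReal (hL : MeasurableFit L) (hreg : ∀ t, (L t).Regular m₀ π₀)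
    (hπ : 0 < π₀) (hπ1 : π₀ ≤ 1) (hM : MissingAtRandom Q) (hO : ResponsePositivity Q)
    (hγ0 : 0 ≤ γ) (hγ1 : γ ≤ 1) (hN : 0 < N) (hδ : 0 < δ)
    (hη : Measurable fun p : 𝒯 × (Fin N → Obs k) => (L p.1).etaHat γ p.2) :
    dataLaw τ Q N {p | ¬ (ENNReal.ofReal (1 - γ) ≤
        (L p.1).containment Q ((L p.1).etaHat γ p.2)
          + ENNReal.ofReal (samplingError Q 40 m₀ π₀ δ N) + (L p.1).productError Q 1 π₀)}
      ≤ ENNReal.ofReal δ := by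
  have := hO.isProbabilityMeasure_attrited
  refine (measure_mono fun p hbad hgood => ?_).trans
    (dataLaw_not_le_le_ofReal (τ := τ) hL hreg hπ hπ1 hM hO hγ0 hγ1 hN hδ
      (hL.measurable_closedCoverage_comp hη) (ae_of_all _ fun t => ae_of_all _ fun s =>
        Fit.infCoverage_le_closedCoverage_etaHat (hL.isMeasurable t)))
  refine hbad (hgood.trans ?_)
  gcongr
  exact Fit.closedCoverage_le_containment _ _ _

lemma dataLaw_not_le_iteCoverage_le_ofReal (hL : MeasurableFit L) (hreg : ∀ t, (L t).Regular m₀ π₀)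
    (hπ : 0 < π₀) (hπ1 : π₀ ≤ 1) (hM : MissingAtRandom Q) (hO : ResponsePositivity Q)
    (hγ0 : 0 ≤ γ) (hγ1 : γ ≤ 1) (hN : 0 < N) (hδ : 0 < δ)
    (hη : Measurable fun p : 𝒯 × (Fin N → Obs k) => (L p.1).etaHat γ p.2) :
    dataLaw τ Q N {p | ¬ (1 ≤ (L p.1).iteCoverage Q ((L p.1).etaHat γ p.2)
          + ((L p.1).surrogateMiss Q + ENNReal.ofReal γ)
          + ENNReal.ofReal (samplingError Q 40 m₀ π₀ δ N) + (L p.1).productError Q 1 π₀)}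
      ≤ ENNReal.ofReal δ := by
  refine (measure_mono fun p hbad hgood => ?_).trans
    (dataLaw_not_le_containment_le_ofReal (τ := τ) hL hreg hπ hπ1 hM hO hγ0 hγ1 hN hδ hη)
  refine hbad ?_
  set samp := ENNReal.ofReal (samplingError Q 40 m₀ π₀ δ N)
  calc (1 : ℝ≥0∞) = ENNReal.ofReal (1 - γ) + ENNReal.ofReal γ := by
        rw [← ENNReal.ofReal_add (sub_nonneg.mpr hγ1) hγ0, sub_add_cancel, ENNReal.ofReal_one]
    _ ≤ (L p.1).iteCoverage Q ((L p.1).etaHat γ p.2) + (L p.1).surrogateMiss Q + samp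
          + (L p.1).productError Q 1 π₀ + ENNReal.ofReal γ := by
        gcongr
        exact hgood.trans (by gcongr; exact Fit.containment_le_iteCoverage_add_surrogateMiss ..)
    _ = _ := by ring

end FiniteSample

section Asymptotics

variable {k : ℕ} {Q : Measure (Obs k)} {γ m₀ π₀ : ℝ}

lemma tendsto_samplingError (Q : Measure (Obs k)) (C₀ m₀ π₀ δ : ℝ) :
    Tendsto (samplingError Q C₀ m₀ π₀ δ) atTop (𝓝 0) := by
  have hsqrt := (Real.continuous_sqrt.tendsto 0).comp
    (tendsto_const_div_atTop_nhds_zero_nat (Real.log (1 / δ) + 1))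
  have hmul := hsqrt.const_mul (C₀ * (π₀⁻¹ * (1 + m₀) / probAttrition Q))
  rwa [Real.sqrt_zero, mul_zero] at hmul

lemma Fit.productError_le_ofReal {F : Fit k} {c : ℝ} (hp : 0 < probAttrition Q) (hπ : 0 < π₀)
    (h : F.piError Q * F.mError Q ≤ ENNReal.ofReal (c * (probAttrition Q * π₀))) :
    F.productError Q 1 π₀ ≤ ENNReal.ofReal c := by
  refine (mul_le_mul_right h _).trans_eq ?_
  rw [← ENNReal.ofReal_mul (by positivity)]
  congr 1
  field_simp

lemma ofReal_one_sub_le_of_errors_le {x miss samp prod : ℝ≥0∞} {α ε : ℝ} (hα : 0 ≤ α)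
    (hγ : 0 ≤ γ) (hε : 0 < ε) (h : 1 ≤ x + (miss + ENNReal.ofReal γ) + samp + prod)
    (hmiss : miss ≤ ENNReal.ofReal (α + ε / 3)) (hsamp : samp ≤ ENNReal.ofReal (ε / 3))
    (hprod : prod ≤ ENNReal.ofReal (ε / 3)) : ENNReal.ofReal (1 - (α + γ) - ε) ≤ x := by
  rw [sub_sub, ENNReal.ofReal_sub _ (by positivity), ENNReal.ofReal_one, tsub_le_iff_right]
  calc 1 ≤ x + (ENNReal.ofReal (α + ε / 3) + ENNReal.ofReal γ) + ENNReal.ofReal (ε / 3)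
        + ENNReal.ofReal (ε / 3) := h.trans (by gcongr)
    _ = x + ENNReal.ofReal (α + ε / 3 + γ + ε / 3 + ε / 3) := by
        rw [add_assoc x, add_assoc x, ← ENNReal.ofReal_add (by positivity) hγ,
          ← ENNReal.ofReal_add (by positivity) (by positivity),
          ← ENNReal.ofReal_add (by positivity) (by positivity)]
    _ = x + ENNReal.ofReal (α + γ + ε) := by
        congr 2
        ring

lemma dataLaw_preimage_fst {𝒯 : Type*} [MeasurableSpace 𝒯] (τ : Measure 𝒯) [SFinite τ]
    [IsProbabilityMeasure Q] (N : ℕ) (A : Set 𝒯) :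
    dataLaw τ Q N (Prod.fst ⁻¹' A) = τ A := by
  rw [dataLaw, ← Set.prod_univ, Measure.prod_prod, measure_univ, mul_one]

lemma tendsto_dataLaw_iteCoverage_lt [IsProbabilityMeasure Q] (hM : MissingAtRandom Q)
    (hO : ResponsePositivity Q) (hγ0 : 0 ≤ γ) (hγ1 : γ ≤ 1) (hπ : 0 < π₀) (hπ1 : π₀ ≤ 1)
    {𝒯 : ℕ → Type*} [∀ n, MeasurableSpace (𝒯 n)] {τ : ∀ n, Measure (𝒯 n)}
    [∀ n, IsProbabilityMeasure (τ n)] {L : ∀ n, 𝒯 n → Fit k} {N : ℕ → ℕ} {α : ℝ}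
    (hL : ∀ n, MeasurableFit (L n)) (hreg : ∀ n t, (L n t).Regular m₀ π₀)
    (hη : ∀ n, Measurable fun p : 𝒯 n × (Fin (N n) → Obs k) => (L n p.1).etaHat γ p.2)
    (hα : 0 ≤ α) (hN : Tendsto N atTop atTop)
    (hmiss : ∀ ε : ℝ, 0 < ε → Tendsto (fun n =>
      τ n {t | ENNReal.ofReal (α + ε) < (L n t).surrogateMiss Q}) atTop (𝓝 0))
    (hprod : ∀ ε : ℝ, 0 < ε → Tendsto (fun n =>
      τ n {t | ENNReal.ofReal ε < (L n t).piError Q * (L n t).mError Q}) atTop (𝓝 0))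
    {ε : ℝ} (hε : 0 < ε) :
    Tendsto (fun n => dataLaw (τ n) Q (N n)
      {p | (L n p.1).iteCoverage Q ((L n p.1).etaHat γ p.2)
        < ENNReal.ofReal (1 - (α + γ) - ε)}) atTop (𝓝 0) := by
  have hp := hO.probAttrition_pos
  have hε3 : 0 < ε / 3 := by positivity
  rw [ENNReal.tendsto_nhds_zero]
  intro κ hκ
  have hκ3 : 0 < κ / 3 := ENNReal.div_pos hκ.ne' ENNReal.ofNat_ne_top
  obtain ⟨δ, hδ0, hδ⟩ := ENNReal.lt_iff_exists_nnreal_btwn.mp hκ3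
  filter_upwards [ENNReal.tendsto_nhds_zero.mp (hmiss _ hε3) _ hκ3,
    ENNReal.tendsto_nhds_zero.mp (hprod (ε / 3 * (probAttrition Q * π₀)) (by positivity)) _ hκ3,
    ((tendsto_samplingError Q 40 m₀ π₀ δ).comp hN).eventually (eventually_le_nhds hε3),
    hN.eventually_gt_atTop 0] with n hmiss_n hprod_n hsamp_n hN_n
  have hfinite := dataLaw_not_le_iteCoverage_le_ofReal (τ := τ n) (hL n) (hreg n) hπ hπ1 hM hO
    hγ0 hγ1 hN_n (NNReal.coe_pos.mpr (ENNReal.coe_pos.mp hδ0)) (hη n)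
  rw [ENNReal.ofReal_coe_nnreal] at hfinite
  rw [← dataLaw_preimage_fst (Q := Q) (τ n) (N n)] at hmiss_n hprod_n
  refine (measure_mono fun p hlt => ?_).trans ((measure_union_le _ _).trans
    ((add_le_add ((measure_union_le _ _).trans (add_le_add (hfinite.trans hδ.le) hmiss_n))
      hprod_n).trans_eq (ENNReal.add_thirds κ)))
  by_contra hgood
  simp only [Set.mem_union, Set.mem_preimage, Set.mem_ofPred_eq, not_or, not_not, not_lt]
    at hgood hlt
  obtain ⟨⟨hcov, hmiss_p⟩, hprod_p⟩ := hgood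
  exact hlt.not_ge (ofReal_one_sub_le_of_errors_le hα hγ0 hε hcov hmiss_p
    (ENNReal.ofReal_le_ofReal hsamp_n) (Fit.productError_le_ofReal hp hπ hprod_p))

end Asymptotics

end Attrition

open Attrition in
theorem theoremB1_general :
    ∃ C₀ C₁ : ℝ, 0 < C₀ ∧ 0 < C₁ ∧
      ∀ (k : ℕ) (Q : Measure (Obs k)) [IsProbabilityMeasure Q],
        MissingAtRandom Q → ResponsePositivity Q →
      ∀ (γ m₀ π₀ : ℝ), 0 ≤ γ → γ ≤ 1 → 0 < π₀ → π₀ ≤ 1 →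
        (∀ (𝒯 : Type*) [MeasurableSpace 𝒯] (τ : Measure 𝒯) [IsProbabilityMeasure τ]
            (L : 𝒯 → Fit k) (N : ℕ),
          MeasurableFit L → (∀ t, (L t).Regular m₀ π₀) → 0 < N →
          (Measurable fun p : 𝒯 × (Fin N → Obs k) => (L p.1).etaHat γ p.2) →
          ∀ δ : ℝ, 0 < δ →
            (((∀ᵐ p ∂(dataLaw τ Q N), (L p.1).Attained γ p.2) ∨
                (∀ᵐ t ∂τ, (L t).Atomless Q)) →
              dataLaw τ Q N {p | ¬ (ENNReal.ofReal (1 - γ) ≤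
                (L p.1).coverage Q ((L p.1).etaHat γ p.2)
                  + ENNReal.ofReal (samplingError Q C₀ m₀ π₀ δ N)
                  + (L p.1).productError Q C₁ π₀)} ≤ ENNReal.ofReal δ) ∧
            dataLaw τ Q N {p | ¬ (ENNReal.ofReal (1 - γ) ≤
                (L p.1).containment Q ((L p.1).etaHat γ p.2)
                  + ENNReal.ofReal (samplingError Q C₀ m₀ π₀ δ N)
                  + (L p.1).productError Q C₁ π₀)} ≤ ENNReal.ofReal δ ∧
            dataLaw τ Q N {p | ¬ (1 ≤
                (L p.1).iteCoverage Q ((L p.1).etaHat γ p.2)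
                  + ((L p.1).surrogateMiss Q + ENNReal.ofReal γ)
                  + ENNReal.ofReal (samplingError Q C₀ m₀ π₀ δ N)
                  + (L p.1).productError Q C₁ π₀)} ≤ ENNReal.ofReal δ) ∧
        (∀ (𝒯 : ℕ → Type*) [∀ n, MeasurableSpace (𝒯 n)] (τ : ∀ n, Measure (𝒯 n))
            [∀ n, IsProbabilityMeasure (τ n)] (L : ∀ n, 𝒯 n → Fit k) (N : ℕ → ℕ) (α : ℝ),
          (∀ n, MeasurableFit (L n)) → (∀ n t, (L n t).Regular m₀ π₀) →
          (∀ n, Measurable fun p : 𝒯 n × (Fin (N n) → Obs k) => (L n p.1).etaHat γ p.2) →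
          0 ≤ α →
          Tendsto N atTop atTop →
          (∀ ε : ℝ, 0 < ε → Tendsto (fun n =>
            τ n {t | ENNReal.ofReal (α + ε) < (L n t).surrogateMiss Q}) atTop (𝓝 0)) →
          (∀ ε : ℝ, 0 < ε → Tendsto (fun n =>
            τ n {t | ENNReal.ofReal ε < (L n t).piError Q * (L n t).mError Q}) atTop (𝓝 0)) →
          ∀ ε : ℝ, 0 < ε → Tendsto (fun n =>
            dataLaw (τ n) Q (N n) {p | (L n p.1).iteCoverage Q ((L n p.1).etaHat γ p.2)
              < ENNReal.ofReal (1 - (α + γ) - ε)}) atTop (𝓝 0)) := by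
  refine ⟨40, 1, by norm_num, one_pos, fun k Q _ hM hO γ m₀ π₀ hγ0 hγ1 hπ hπ1 => ⟨?_, ?_⟩⟩
  · intro 𝒯 _ τ _ L N hL hreg hN hη δ hδ
    exact ⟨dataLaw_not_le_coverage_le_ofReal hL hreg hπ hπ1 hM hO hγ0 hγ1 hN hδ hη,
      dataLaw_not_le_containment_le_ofReal hL hreg hπ hπ1 hM hO hγ0 hγ1 hN hδ hη,
      dataLaw_not_le_iteCoverage_le_ofReal hL hreg hπ hπ1 hM hO hγ0 hγ1 hN hδ hη⟩
  · intro 𝒯 _ τ _ L N α hL hreg hη hα hN hmiss hprod ε hε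
    exact tendsto_dataLaw_iteCoverage_lt hM hO hγ0 hγ1 hπ hπ1 hL hreg hη hα hN hmiss hprod hε

open Attrition in
theorem theoremB1 :
    ∃ C₀ C₁ : ℝ, 0 < C₀ ∧ 0 < C₁ ∧
      ∀ (k : ℕ) (Q : Measure (Obs k)) [IsProbabilityMeasure Q],
        Unconfounded Q → MissingAtRandom Q → Overlap Q →
      ∀ (γ m₀ π₀ : ℝ), 0 < γ → γ < 1 → 0 < π₀ → π₀ ≤ 1 →
        -- finite samples
        (∀ (𝒯 : Type*) [MeasurableSpace 𝒯] (τ : Measure 𝒯) [IsProbabilityMeasure τ]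
            (L : 𝒯 → Fit k) (N : ℕ),
          MeasurableFit L → (∀ t, (L t).Regular m₀ π₀) → 0 < N →
          (Measurable fun p : 𝒯 × (Fin N → Obs k) => (L p.1).etaHat γ p.2) →
          ∀ δ : ℝ, 0 < δ →
            (((∀ᵐ p ∂(dataLaw τ Q N), (L p.1).Attained γ p.2) ∨
                (∀ᵐ t ∂τ, (L t).Atomless Q)) →
              dataLaw τ Q N {p | ¬ (ENNReal.ofReal (1 - γ) ≤
                (L p.1).coverage Q ((L p.1).etaHat γ p.2)
                  + ENNReal.ofReal (samplingError Q C₀ m₀ π₀ δ N)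
                  + (L p.1).productError Q C₁ π₀)} ≤ ENNReal.ofReal δ) ∧
            dataLaw τ Q N {p | ¬ (ENNReal.ofReal (1 - γ) ≤
                (L p.1).containment Q ((L p.1).etaHat γ p.2)
                  + ENNReal.ofReal (samplingError Q C₀ m₀ π₀ δ N)
                  + (L p.1).productError Q C₁ π₀)} ≤ ENNReal.ofReal δ ∧
            dataLaw τ Q N {p | ¬ (1 ≤
                (L p.1).iteCoverage Q ((L p.1).etaHat γ p.2)
                  + ((L p.1).surrogateMiss Q + ENNReal.ofReal γ)
                  + ENNReal.ofReal (samplingError Q C₀ m₀ π₀ δ N)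
                  + (L p.1).productError Q C₁ π₀)} ≤ ENNReal.ofReal δ) ∧
        -- asymptotic coverage of the individual treatment effect
        (∀ (𝒯 : ℕ → Type*) [∀ n, MeasurableSpace (𝒯 n)] (τ : ∀ n, Measure (𝒯 n))
            [∀ n, IsProbabilityMeasure (τ n)] (L : ∀ n, 𝒯 n → Fit k) (N : ℕ → ℕ) (α : ℝ),
          (∀ n, MeasurableFit (L n)) → (∀ n t, (L n t).Regular m₀ π₀) →
          (∀ n, Measurable fun p : 𝒯 n × (Fin (N n) → Obs k) => (L n p.1).etaHat γ p.2) →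
          0 < α → α < 1 →
          Tendsto N atTop atTop →
          (∀ ε : ℝ, 0 < ε → Tendsto (fun n =>
            τ n {t | ENNReal.ofReal (α + ε) < (L n t).surrogateMiss Q}) atTop (𝓝 0)) →
          (∀ ε : ℝ, 0 < ε → Tendsto (fun n =>
            τ n {t | ENNReal.ofReal ε < (L n t).piError Q * (L n t).mError Q}) atTop (𝓝 0)) →
          ∀ ε : ℝ, 0 < ε → Tendsto (fun n =>
            dataLaw (τ n) Q (N n) {p | (L n p.1).iteCoverage Q ((L n p.1).etaHat γ p.2)
              < ENNReal.ofReal (1 - (α + γ) - ε)}) atTop (𝓝 0)) := by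
  obtain ⟨C₀, C₁, hC₀, hC₁, h⟩ := theoremB1_general
  refine ⟨C₀, C₁, hC₀, hC₁, fun k Q _ _ hM hO γ m₀ π₀ hγ0 hγ1 hπ hπ1 => ?_⟩
  obtain ⟨hfinite, hasymp⟩ := h k Q hM hO.responsePositivity γ m₀ π₀ hγ0.le hγ1.le hπ hπ1
  exact ⟨hfinite, fun 𝒯 _ τ _ L N α hL hreg hη hα _ => hasymp 𝒯 τ L N α hL hreg hη hα.le⟩
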